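/- Let $A$ be a $C^*$-algebra and $G$ a (discrete) group with unit $e$. A twisted partial action $(\alpha,u)$ of $G$ on $A$ consists of closed ideals $A_s$ of $A$, $*$-isomorphisms $\alpha_s:A_{s^{-1}}\to A_s$ ($s\in G$) and unitary multipliers $u_{r,s}$ of $A_rA_{rs}$ such that for all $r,s,t\in G$: $A_e=A$ and $\alpha_e=\mathrm{id}$; $\alpha_r(A_{r^{-1}}A_s)=A_rA_{rs}$; $\alpha_r(\alpha_s(a))=u_{r,s}\alpha_{rs}(a)u_{r,s}^*$ for $a\in A_{s^{-1}}A_{s^{-1}r^{-1}}$; $u_{e,t}=u_{t,e}=1$; and $\alpha_r(au_{s,t})u_{r,st}=\alpha_r(a)u_{r,s}u_{rs,t}$ for $a\in A_{r^{-1}}A_sA_{st}$. Exel's crossed product $A\times_{\alpha,u}G$ is the enveloping $C^*$-algebra (the Hausdorff completion in the supremum of the seminorms given by all $*$-representations on Hilbert spaces) of the Banach $*$-algebra $L^1(B)=\{x\in\ell^1(G,A):x(s)\in A_s\text{ for all }s\}$ of the semidirect product bundle $B$, whose operations are determined by $$(a\delta_s)(b\delta_t)=\alpha_s(\alpha_s^{-1}(a)b)u_{s,t}\,\delta_{st},\qquad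 (a\delta_s)^*=\alpha_s^{-1}(a^*)u_{s^{-1},s}^*\,\delta_{s^{-1}}.$$ Let $S(G)$ be the unital inverse semigroup associated with $G$. Its elements are written in canonical form $[g_1][g_1^{-1}]\cdots[g_m][g_m^{-1}][s]$ ($g_i,s\in G$), which is determined by $s$ and the finite set $\{e,s,g_1,\dots,g_m\}$; the operations are $$[g_1][g_1^{-1}]\cdots[g_m][g_m^{-1}][s]\cdot[h_1][h_1^{-1}]\cdots[h_n][h_n^{-1}][t]=[g_1][g_1^{-1}]\cdots[g_m][g_m^{-1}][s][s^{-1}][sh_1][(sh_1)^{-1}]\cdots[sh_n][(sh_n)^{-1}][st]$$ and $([g_1][g_1^{-1}]\cdots[g_m][g_m^{-1}][s])^*=[s^{-1}g_m][(s^{-1}g_m)^{-1}]\cdots[s^{-1}g_1][(s^{-1}g_1)^{-1}][s^{-1}]$. A Busby–Smith twisted action $(\beta,w)$ of a unital inverse semigroup $S$ with unit $1_S$ on $A$ consists of closed ideals $A_p$, $*$-isomorphisms $\beta_p:A_{p^*}\to A_p$ and unitary multipliers $w_{p,q}$ of $A_{pq}$ ($p,q\in S$) such that $A_{1_S}=A$;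 $\beta_p\beta_q=\mathrm{Ad}\,w_{p,q}\circ\beta_{pq}$ as partially defined maps; $w_{p,q}=1_{M(A_{pq})}$ if $p$ or $q$ is idempotent; and $\beta_r(aw_{p,q})w_{r,pq}=\beta_r(a)w_{r,p}w_{rp,q}$ for $a\in A_{r^*}A_{pq}$. A covariant representation $(\pi,V)$ on a Hilbert space $H$ consists of a nondegenerate representation $\pi$ of $A$ on $H$ and partial isometries $V_p$ with initial space $\pi(A_{p^*})H$ and final space $\pi(A_p)H$ such that $V_pV_q=\pi(w_{p,q})V_{pq}$ for all $p,q\in S$ and $\pi(\beta_p(a))=V_p\pi(a)V_p^*$ for $a\in A_{p^*}$. The crossed product $A\times_{\beta,w}S$ is the Hausdorff completion of $\{x\in\ell^1(S,A):x(p)\in A_p\text{ for all }p\}$, with operations determined by the formulas above (with $\beta,w$ in place of $\alpha,u$ and $p^*$ in place of $s^{-1}$), in the $C^*$-seminorm $\|x\|=\sup\|\sum_p\pi(x(p))V_p\|$ over all covariant representations $(\pi,V)$. The action $(A,S(G),\beta,w)$ corresponds to $(A,G,\alpha,u)$ if, for $p=[g_1][g_1^{-1}]\cdots[g_m][g_m^{-1}][s]$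 and $q=[h_1][h_1^{-1}]\cdots[h_n][h_n^{-1}][t]$, one has $A_p=A_{g_1}\cdots A_{g_m}A_s$, $\beta_p=\alpha_{g_1}\alpha_{g_1}^{-1}\cdots\alpha_{g_m}\alpha_{g_m}^{-1}\alpha_s$ and $w_{p,q}=1_{M(A_{pq})}u_{s,t}$. **Proposition.** If the Busby–Smith twisted action $(A,S(G),\beta,w)$ corresponds to the twisted partial action $(A,G,\alpha,u)$, then the crossed products $A\times_{\alpha,u}G$ and $A\times_{\beta,w}S(G)$ are isomorphic $C^*$-algebras. -/

import Mathlib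

open scoped MultiplierAlgebra ENNReal InnerProductSpace
open ContinuousLinearMap

noncomputable section

/-! ### Closed ideals, partial automorphisms and their multipliers -/

section Ideals

variable {A : Type*} [NonUnitalCStarAlgebra A]

instance instCStarRingSubalgebra (I : NonUnitalStarSubalgebra ℂ A) : CStarRing I where
  norm_mul_self_le x := (CStarRing.norm_star_mul_self (x := (x : A))).symm.le

/-- `I` is a closed two-sided ideal of the C*-algebra `A`. (Closed two-sided ideals of C*-algebras
are automatically self-adjoint, so it is harmless to bundle them as `*`-subalgebras. The product
`I J` of two closed ideals is their intersection `I ⊓ J`.) -/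
structure IsClosedIdeal (I : NonUnitalStarSubalgebra ℂ A) : Prop where
  isClosed : IsClosed (I : Set A)
  mul_mem_left : ∀ (a : A) {x : A}, x ∈ I → a * x ∈ I
  mul_mem_right : ∀ (a : A) {x : A}, x ∈ I → x * a ∈ I

open Classical in
/-- The partially defined map `f : I → J` as a function on `A`; only its values on the domain `I`
are ever used (the value off `I` is a dummy). -/
def pmap {I J : NonUnitalStarSubalgebra ℂ A} (f : I ≃⋆ₐ[ℂ] J) (a : A) : A :=
  if h : a ∈ I then (f ⟨a, h⟩ : A) else 0

open Classical in
/-- `m a` for a multiplier `m` of the ideal `I` and `a ∈ I` (a dummy value for `a ∉ I`). -/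
def lmul {I : NonUnitalStarSubalgebra ℂ A} (m : 𝓜(ℂ, I)) (a : A) : A :=
  if h : a ∈ I then (m.toProd.1 ⟨a, h⟩ : A) else 0

open Classical in
/-- `a m` for a multiplier `m` of the ideal `I` and `a ∈ I` (a dummy value for `a ∉ I`). -/
def rmul {I : NonUnitalStarSubalgebra ℂ A} (m : 𝓜(ℂ, I)) (a : A) : A :=
  if h : a ∈ I then (m.toProd.2 ⟨a, h⟩ : A) else 0

/-- `Ad m (a) = m a m*` for a multiplier `m` of the ideal `I` and `a ∈ I`. -/
def adMul {I : NonUnitalStarSubalgebra ℂ A} (m : 𝓜(ℂ, I)) (a : A) : A :=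
  rmul (star m) (lmul m a)

variable {I J : NonUnitalStarSubalgebra ℂ A}

theorem pmap_coe (f : I ≃⋆ₐ[ℂ] J) (a : I) : pmap f (a : A) = f a := by
  simp [pmap]

theorem pmap_mem (f : I ≃⋆ₐ[ℂ] J) {a : A} (h : a ∈ I) : pmap f a ∈ J := by
  simp [pmap, h]

theorem lmul_coe (m : 𝓜(ℂ, I)) (a : I) : lmul m (a : A) = m.toProd.1 a := by
  simp [lmul]

theorem lmul_mem (m : 𝓜(ℂ, I)) {a : A} (h : a ∈ I) : lmul m a ∈ I := by
  simp [lmul, h]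

theorem rmul_coe (m : 𝓜(ℂ, I)) (a : I) : rmul m (a : A) = m.toProd.2 a := by
  simp [rmul]

theorem rmul_mem (m : 𝓜(ℂ, I)) {a : A} (h : a ∈ I) : rmul m a ∈ I := by
  simp [rmul, h]

theorem adMul_mem (m : 𝓜(ℂ, I)) {a : A} (h : a ∈ I) : adMul m a ∈ I :=
  rmul_mem _ (lmul_mem _ h)

theorem pmap_symm_pmap (f : I ≃⋆ₐ[ℂ] J) {a : A} (h : a ∈ I) : pmap f.symm (pmap f a) = a := by
  lift a to I using h
  rw [pmap_coe, pmap_coe]; simp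

theorem pmap_pmap_symm (f : I ≃⋆ₐ[ℂ] J) {a : A} (h : a ∈ J) : pmap f (pmap f.symm a) = a := by
  lift a to J using h
  rw [pmap_coe, pmap_coe]; simp

theorem pmap_add (f : I ≃⋆ₐ[ℂ] J) {a b : A} (ha : a ∈ I) (hb : b ∈ I) :
    pmap f (a + b) = pmap f a + pmap f b := by
  lift a to I using ha
  lift b to I using hb
  rw [← AddMemClass.coe_add, pmap_coe, pmap_coe, pmap_coe, map_add, AddMemClass.coe_add]

theorem pmap_smul (f : I ≃⋆ₐ[ℂ] J) (c : ℂ) {a : A} (ha : a ∈ I) :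
    pmap f (c • a) = c • pmap f a := by
  lift a to I using ha
  rw [← SetLike.val_smul, pmap_coe, pmap_coe, map_smul, SetLike.val_smul]

theorem pmap_mul (f : I ≃⋆ₐ[ℂ] J) {a b : A} (ha : a ∈ I) (hb : b ∈ I) :
    pmap f (a * b) = pmap f a * pmap f b := by
  lift a to I using ha
  lift b to I using hb
  rw [← MulMemClass.coe_mul, pmap_coe, pmap_coe, pmap_coe, map_mul, MulMemClass.coe_mul]

theorem rmul_add (m : 𝓜(ℂ, I)) {a b : A} (ha : a ∈ I) (hb : b ∈ I) :
    rmul m (a + b) = rmul m a + rmul m b := by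
  lift a to I using ha
  lift b to I using hb
  rw [← AddMemClass.coe_add, rmul_coe, rmul_coe, rmul_coe, map_add, AddMemClass.coe_add]

theorem rmul_smul (m : 𝓜(ℂ, I)) (c : ℂ) {a : A} (ha : a ∈ I) :
    rmul m (c • a) = c • rmul m a := by
  lift a to I using ha
  rw [← SetLike.val_smul, rmul_coe, rmul_coe, map_smul, SetLike.val_smul]

theorem rmul_mul (m : 𝓜(ℂ, I)) {a b : A} (ha : a ∈ I) (hb : b ∈ I) :
    rmul m a * b = a * lmul m b := by
  lift a to I using ha
  lift b to I using hb
  rw [rmul_coe, lmul_coe]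
  exact congrArg Subtype.val (m.central a b)

theorem rmul_rmul_star {m : 𝓜(ℂ, I)} (hm : m ∈ unitary 𝓜(ℂ, I)) {a : A} (ha : a ∈ I) :
    rmul m (rmul (star m) a) = a := by
  lift a to I using ha
  rw [rmul_coe, rmul_coe]
  have h := congrArg (fun x : 𝓜(ℂ, I) => (x.toProd.2 a : A)) (Unitary.mem_iff.1 hm).1
  exact h

theorem norm_pmap (hI : IsClosed (I : Set A)) (hJ : IsClosed (J : Set A)) (f : I ≃⋆ₐ[ℂ] J)
    {a : A} (h : a ∈ I) : ‖pmap f a‖ = ‖a‖ := by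
  have := hI
  have := hJ
  lift a to I using h
  rw [pmap_coe]
  exact StarAlgEquiv.norm_map f a

theorem norm_le_one_of_unitary {m : 𝓜(ℂ, I)} (hm : m ∈ unitary 𝓜(ℂ, I)) : ‖m‖ ≤ 1 := by
  have h1 : ‖m‖ * ‖m‖ = ‖(1 : 𝓜(ℂ, I))‖ := by
    rw [← CStarRing.norm_star_mul_self, (Unitary.mem_iff.1 hm).1]
  have h2 : ‖(1 : 𝓜(ℂ, I))‖ ≤ 1 := by
    rw [← DoubleCentralizer.norm_fst]
    exact ContinuousLinearMap.norm_id_le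
  nlinarith [norm_nonneg m]

theorem norm_rmul_le {m : 𝓜(ℂ, I)} (hm : m ∈ unitary 𝓜(ℂ, I)) {a : A} (h : a ∈ I) :
    ‖rmul m a‖ ≤ ‖a‖ := by
  lift a to I using h
  rw [rmul_coe]
  calc ‖(m.toProd.2 a : A)‖ = ‖m.toProd.2 a‖ := rfl
    _ ≤ ‖m.toProd.2‖ * ‖a‖ := m.toProd.2.le_opNorm a
    _ ≤ 1 * ‖a‖ := by
      rw [DoubleCentralizer.norm_snd]
      gcongr
      exact norm_le_one_of_unitary hm
    _ = ‖(a : A)‖ := one_mul _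

end Ideals

/-! ### Twisted systems and their convolution algebras -/

section Convolution

/-- The common shape of the data of a twisted partial action of a group and of a Busby–Smith
twisted action of an inverse semigroup: closed ideals `D s`, isomorphisms `α s : D s⁻¹ → D s` and
unitary multipliers `u s t` of ideals `J s t`. The last three fields only say that the formulas
for `(a δ_s) (b δ_t)` and `(a δ_s)*` below make sense. -/
structure TwistedSystem (S A : Type*) [DivisionMonoid S] [NonUnitalCStarAlgebra A] where
  D : S → NonUnitalStarSubalgebra ℂ A
  isClosedIdeal : ∀ s, IsClosedIdeal (D s)
  α : ∀ s, D s⁻¹ ≃⋆ₐ[ℂ] D s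
  J : S → S → NonUnitalStarSubalgebra ℂ A
  u : ∀ s t, 𝓜(ℂ, J s t)
  u_unitary : ∀ s t, u s t ∈ unitary 𝓜(ℂ, J s t)
  J_le : ∀ s t, J s t ≤ D (s * t)
  map_mem : ∀ s t, ∀ a ∈ D s⁻¹, a ∈ D t → pmap (α s) a ∈ J s t
  J_inv : ∀ s, J s⁻¹ s = D s⁻¹

variable {S A : Type*} [DivisionMonoid S] [NonUnitalCStarAlgebra A]

namespace TwistedSystem

variable (T : TwistedSystem S A)

/-- The coefficient `α_s(α_s⁻¹(a) b) u_{s,t}` of `(a δ_s) (b δ_t)` at `δ_{st}`. -/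
def fmul (s t : S) (a b : A) : A :=
  rmul (T.u s t) (pmap (T.α s) (pmap (T.α s).symm a * b))

/-- The coefficient `α_s⁻¹(a*) u_{s⁻¹,s}*` of `(a δ_s)*` at `δ_{s⁻¹}`. -/
def fstar (s : S) (a : A) : A :=
  rmul (star (T.u s⁻¹ s)) (pmap (T.α s).symm (star a))

theorem inner_mem {s t : S} {a b : A} (ha : a ∈ T.D s) (hb : b ∈ T.D t) :
    pmap (T.α s).symm a * b ∈ T.D s⁻¹ ∧ pmap (T.α s).symm a * b ∈ T.D t :=
  ⟨(T.isClosedIdeal _).mul_mem_right _ (pmap_mem _ ha), (T.isClosedIdeal _).mul_mem_left _ hb⟩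

theorem fmul_mem_J {s t : S} {a b : A} (ha : a ∈ T.D s) (hb : b ∈ T.D t) :
    pmap (T.α s) (pmap (T.α s).symm a * b) ∈ T.J s t :=
  T.map_mem s t _ (T.inner_mem ha hb).1 (T.inner_mem ha hb).2

theorem fmul_mem {s t : S} {a b : A} (ha : a ∈ T.D s) (hb : b ∈ T.D t) :
    T.fmul s t a b ∈ T.D (s * t) :=
  T.J_le s t (rmul_mem _ (T.fmul_mem_J ha hb))

theorem fstar_mem {s : S} {a : A} (ha : a ∈ T.D s) : T.fstar s a ∈ T.D s⁻¹ := by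
  rw [← T.J_inv s]
  refine rmul_mem _ ?_
  rw [T.J_inv s]
  exact pmap_mem _ (star_mem ha)

theorem norm_fmul_le {s t : S} {a b : A} (ha : a ∈ T.D s) (hb : b ∈ T.D t) :
    ‖T.fmul s t a b‖ ≤ ‖a‖ * ‖b‖ := by
  have hc := fun s => (T.isClosedIdeal s).isClosed
  calc ‖T.fmul s t a b‖ ≤ ‖pmap (T.α s) (pmap (T.α s).symm a * b)‖ :=
        norm_rmul_le (T.u_unitary s t) (T.fmul_mem_J ha hb)
    _ = ‖pmap (T.α s).symm a * b‖ := norm_pmap (hc _) (hc _) _ (T.inner_mem ha hb).1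
    _ ≤ ‖pmap (T.α s).symm a‖ * ‖b‖ := norm_mul_le _ _
    _ = ‖a‖ * ‖b‖ := by rw [norm_pmap (hc _) (hc _) _ ha]

theorem norm_fstar_le {s : S} {a : A} (ha : a ∈ T.D s) : ‖T.fstar s a‖ ≤ ‖a‖ := by
  have hc := fun s => (T.isClosedIdeal s).isClosed
  have h : pmap (T.α s).symm (star a) ∈ T.J s⁻¹ s := by
    rw [T.J_inv s]; exact pmap_mem _ (star_mem ha)
  calc ‖T.fstar s a‖ ≤ ‖pmap (T.α s).symm (star a)‖ :=
        norm_rmul_le (Unitary.star_mem (T.u_unitary _ _)) h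
    _ = ‖star a‖ := norm_pmap (hc _) (hc _) _ (star_mem ha)
    _ = ‖a‖ := norm_star a

/-- `(a, b) ↦ α_s(α_s⁻¹(a) b) u_{s,t}` as a bounded bilinear map `D s × D t → D (s t)`. -/
def fmulCLM (s t : S) : T.D s →L[ℂ] T.D t →L[ℂ] T.D (s * t) :=
  LinearMap.mkContinuous₂
    (LinearMap.mk₂ ℂ (fun a b => (⟨T.fmul s t a b, T.fmul_mem a.2 b.2⟩ : T.D (s * t)))
      (fun a a' b => by
        apply Subtype.ext
        simp only [fmul, AddMemClass.coe_add]
        rw [pmap_add _ a.2 a'.2, add_mul, pmap_add _ (T.inner_mem a.2 b.2).1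
          (T.inner_mem a'.2 b.2).1, rmul_add _ (T.fmul_mem_J a.2 b.2) (T.fmul_mem_J a'.2 b.2)])
      (fun c a b => by
        apply Subtype.ext
        simp only [fmul, SetLike.val_smul]
        rw [pmap_smul _ _ a.2, smul_mul_assoc, pmap_smul _ _ (T.inner_mem a.2 b.2).1,
          rmul_smul _ _ (T.fmul_mem_J a.2 b.2)])
      (fun a b b' => by
        apply Subtype.ext
        simp only [fmul, AddMemClass.coe_add]
        rw [mul_add, pmap_add _ (T.inner_mem a.2 b.2).1
          (T.inner_mem a.2 b'.2).1, rmul_add _ (T.fmul_mem_J a.2 b.2) (T.fmul_mem_J a.2 b'.2)])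
      (fun c a b => by
        apply Subtype.ext
        simp only [fmul, SetLike.val_smul]
        rw [mul_smul_comm, pmap_smul _ _ (T.inner_mem a.2 b.2).1,
          rmul_smul _ _ (T.fmul_mem_J a.2 b.2)]))
    1 (fun a b => by
      rw [one_mul]
      exact T.norm_fmul_le a.2 b.2)

theorem coe_fmulCLM (s t : S) (a : T.D s) (b : T.D t) :
    (T.fmulCLM s t a b : A) = T.fmul s t a b := rfl

theorem norm_fmulCLM_le (s t : S) (a : T.D s) : ‖T.fmulCLM s t a‖ ≤ ‖a‖ :=
  ContinuousLinearMap.opNorm_le_bound _ (norm_nonneg _) fun b => T.norm_fmul_le a.2 b.2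

/-- The space of all `x ∈ ℓ¹(S, A)` with `x s ∈ D s` for all `s`. -/
def L1 : Type _ := lp (fun s => T.D s) 1

instance : NormedAddCommGroup T.L1 := inferInstanceAs (NormedAddCommGroup (lp (fun s => T.D s) 1))

instance : NormedSpace ℂ T.L1 := inferInstanceAs (NormedSpace ℂ (lp (fun s => T.D s) 1))

instance : CompleteSpace T.L1 :=
  have := fun s => (T.isClosedIdeal s).isClosed.completeSpace_coe
  inferInstanceAs (CompleteSpace (lp (fun s => T.D s) 1))

variable {T} in
/-- The value at `s` of `x`, an element of `D s`. -/
def L1.coeff (x : T.L1) (s : S) : T.D s := (show lp (fun s => T.D s) 1 from x) s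

open Classical in
/-- The element `a δ_s`, as a bounded linear function of `a ∈ D s`. -/
def single (s : S) : T.D s →L[ℂ] T.L1 :=
  lp.singleContinuousLinearMap ℂ (fun s => T.D s) 1 s

variable {T} in
theorem L1.hasSum_norm (x : T.L1) : HasSum (fun s => ‖x.coeff s‖) ‖x‖ := by
  have := lp.hasSum_norm (p := 1) (by simp) (show lp (fun s => T.D s) 1 from x)
  simpa using! this

variable {T} in
theorem L1.norm_apply_le {V : Type*} [NormedAddCommGroup V] [NormedSpace ℂ V]
    (F : ∀ s, T.D s →L[ℂ] V) (C : ℝ) (hF : ∀ s, ‖F s‖ ≤ C) (x : T.L1) (s : S) :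
    ‖F s (x.coeff s)‖ ≤ C * ‖x.coeff s‖ :=
  (F s).le_of_opNorm_le (hF s) _

variable {T} in
theorem L1.summable_lift {V : Type*} [NormedAddCommGroup V] [NormedSpace ℂ V] [CompleteSpace V]
    (F : ∀ s, T.D s →L[ℂ] V) (C : ℝ) (hF : ∀ s, ‖F s‖ ≤ C) (x : T.L1) :
    Summable fun s => F s (x.coeff s) :=
  Summable.of_norm_bounded (x.hasSum_norm.summable.mul_left C) (L1.norm_apply_le F C hF x)

variable {T} in
theorem L1.norm_lift_le {V : Type*} [NormedAddCommGroup V] [NormedSpace ℂ V]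
    (F : ∀ s, T.D s →L[ℂ] V) (C : ℝ) (hF : ∀ s, ‖F s‖ ≤ C) (x : T.L1) :
    ‖∑' s, F s (x.coeff s)‖ ≤ C * ‖x‖ :=
  tsum_of_norm_bounded (x.hasSum_norm.mul_left C) (L1.norm_apply_le F C hF x)

variable {T} in
/-- The bounded linear map `x ↦ ∑ s, F s (x s)` on `L1` for a bounded family `F` of bounded
linear maps. -/
def L1.lift {V : Type*} [NormedAddCommGroup V] [NormedSpace ℂ V] [CompleteSpace V]
    (F : ∀ s, T.D s →L[ℂ] V) (C : ℝ) (hF : ∀ s, ‖F s‖ ≤ C) : T.L1 →L[ℂ] V :=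
  LinearMap.mkContinuous
    { toFun := fun x => ∑' s, F s (x.coeff s)
      map_add' := fun x y => by
        rw [← (L1.summable_lift F C hF x).tsum_add (L1.summable_lift F C hF y)]
        exact tsum_congr fun s => map_add (F s) _ _
      map_smul' := fun c x => by
        rw [RingHom.id_apply, ← (L1.summable_lift F C hF x).tsum_const_smul]
        exact tsum_congr fun s => map_smul (F s) c _ }
    C (fun x => L1.norm_lift_le F C hF x)

variable {T} in
theorem L1.lift_apply {V : Type*} [NormedAddCommGroup V] [NormedSpace ℂ V] [CompleteSpace V]
    (F : ∀ s, T.D s →L[ℂ] V) (C : ℝ) (hF : ∀ s, ‖F s‖ ≤ C) (x : T.L1) :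
    L1.lift F C hF x = ∑' s, F s (x.coeff s) := rfl

variable {T} in
theorem L1.lift_single {V : Type*} [NormedAddCommGroup V] [NormedSpace ℂ V] [CompleteSpace V]
    (F : ∀ s, T.D s →L[ℂ] V) (C : ℝ) (hF : ∀ s, ‖F s‖ ≤ C) (s : S) (a : T.D s) :
    L1.lift F C hF (T.single s a) = F s a := by
  classical
  rw [L1.lift_apply, tsum_eq_single s]
  · congr 1
    exact lp.single_apply_self (E := fun s => T.D s) 1 s a
  · intro t ht
    have : (T.single s a).coeff t = 0 := lp.single_apply_ne (E := fun s => T.D s) 1 s a ht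
    rw [this, map_zero]

variable {T} in
theorem L1.norm_lift {V : Type*} [NormedAddCommGroup V] [NormedSpace ℂ V] [CompleteSpace V]
    (F : ∀ s, T.D s →L[ℂ] V) {C : ℝ} (hC : 0 ≤ C) (hF : ∀ s, ‖F s‖ ≤ C) :
    ‖L1.lift F C hF‖ ≤ C :=
  LinearMap.mkContinuous_norm_le _ hC _

theorem norm_single_le (s : S) : ‖T.single s‖ ≤ 1 :=
  ContinuousLinearMap.opNorm_le_bound _ zero_le_one fun a => by
    classical
    rw [one_mul]
    exact (lp.norm_single (E := fun s => T.D s) (p := 1) (by simp) s a).le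

variable {T} in
/-- Bounded linear maps on `L1` are determined by their values on the elements `a δ_s`. -/
theorem L1.hom_ext {V : Type*} [NormedAddCommGroup V] [NormedSpace ℂ V]
    {f g : T.L1 →L[ℂ] V} (h : ∀ s (a : T.D s), f (T.single s a) = g (T.single s a)) : f = g := by
  classical
  exact lp.ext_continuousLinearMap (E := fun s => T.D s) (p := 1) (by simp)
    fun s => ContinuousLinearMap.ext fun a => h s a

theorem norm_single_comp_le (s : S) (a : T.D s) (t : S) :
    ‖(T.single (s * t)).comp (T.fmulCLM s t a)‖ ≤ ‖a‖ := by
  have h1 := T.norm_single_le (s * t)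
  have h2 := T.norm_fmulCLM_le s t a
  calc _ ≤ ‖T.single (s * t)‖ * ‖T.fmulCLM s t a‖ := ContinuousLinearMap.opNorm_comp_le _ _
    _ ≤ 1 * ‖a‖ := by gcongr
    _ = ‖a‖ := one_mul _

/-- `b ↦ (a δ_s) b`. -/
def mulSingle (s : S) (a : T.D s) : T.L1 →L[ℂ] T.L1 :=
  L1.lift (fun t => (T.single (s * t)).comp (T.fmulCLM s t a)) ‖a‖ (T.norm_single_comp_le s a)

theorem norm_mulSingle_le (s : S) (a : T.D s) : ‖T.mulSingle s a‖ ≤ ‖a‖ :=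
  L1.norm_lift _ (norm_nonneg a) _

/-- The convolution product of `L1` as a bounded bilinear map. -/
def mulCLM : T.L1 →L[ℂ] T.L1 →L[ℂ] T.L1 :=
  L1.lift (fun s => LinearMap.mkContinuous
    { toFun := fun a => T.mulSingle s a
      map_add' := fun a b => L1.hom_ext fun t c => by
        simp [mulSingle, L1.lift_single]
      map_smul' := fun c a => L1.hom_ext fun t b => by
        simp [mulSingle, L1.lift_single] } 1
      fun a => by
        rw [one_mul]
        exact T.norm_mulSingle_le s a) 1
    fun s => LinearMap.mkContinuous_norm_le _ zero_le_one _

instance : Mul T.L1 := ⟨fun x y => T.mulCLM x y⟩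

theorem mul_eq_mulCLM (x y : T.L1) : x * y = T.mulCLM x y := rfl

/-- `(a δ_s) (b δ_t) = α_s(α_s⁻¹(a) b) u_{s,t} δ_{st}`. -/
theorem single_mul_single (s t : S) (a : T.D s) (b : T.D t) :
    T.single s a * T.single t b = T.single (s * t) (T.fmulCLM s t a b) := by
  rw [mul_eq_mulCLM, mulCLM, L1.lift_single]
  exact L1.lift_single _ _ (T.norm_single_comp_le s a) t b

instance : NonUnitalNonAssocRing T.L1 :=
  { (inferInstance : AddCommGroup T.L1), (inferInstance : Mul T.L1) with
    left_distrib := fun x y z => map_add (T.mulCLM x) y z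
    right_distrib := fun x y z => by
      simp only [mul_eq_mulCLM, map_add, _root_.add_apply]
    zero_mul := fun x => by
      simp only [mul_eq_mulCLM, map_zero, _root_.zero_apply]
    mul_zero := fun x => map_zero (T.mulCLM x) }

theorem fstar_inv_mem (x : T.L1) (s : S) : T.fstar s⁻¹ (x.coeff s⁻¹) ∈ T.D s := by
  have h := T.fstar_mem (x.coeff s⁻¹).2
  rwa [inv_inv] at h

/-- The involution of `L1`: the coefficient of `x*` at `δ_s` is that of `(x(s⁻¹) δ_{s⁻¹})*`. -/
instance : Star T.L1 :=
  ⟨fun x => (⟨fun s => (⟨T.fstar s⁻¹ (x.coeff s⁻¹), T.fstar_inv_mem x s⟩ : T.D s), by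
    refine memℓp_gen ?_
    simp only [ENNReal.toReal_one, Real.rpow_one]
    refine Summable.of_nonneg_of_le (fun _ => norm_nonneg _)
      (fun s => T.norm_fstar_le (x.coeff s⁻¹).2) ?_
    exact (Equiv.inv S).summable_iff.2 x.hasSum_norm.summable⟩ : lp (fun s => T.D s) 1)⟩

theorem coeff_star (x : T.L1) (s : S) :
    ((star x).coeff s : A) = T.fstar s⁻¹ (x.coeff s⁻¹) := rfl

/-- A (contractive) `*`-representation of the Banach `*`-algebra `L1` on a Hilbert space.
(For Banach `*`-algebras contractivity is automatic.) -/
structure StarRep.{w, v, u} {S : Type v} {A : Type u} [DivisionMonoid S]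
    [NonUnitalCStarAlgebra A] (T : TwistedSystem S A) where
  H : Type w
  [normedAddCommGroup : NormedAddCommGroup H]
  [innerProductSpace : InnerProductSpace ℂ H]
  [completeSpace : CompleteSpace H]
  φ : T.L1 →⋆ₙₐ[ℂ] (H →L[ℂ] H)
  norm_le : ∀ x, ‖φ x‖ ≤ ‖x‖

attribute [instance] StarRep.normedAddCommGroup StarRep.innerProductSpace StarRep.completeSpace

/-- The representation `x ↦ ∑ s, W s (x s)` obtained from maps `W s` that are compatible with
products and adjoints. -/
def StarRep.ofFamily {H : Type*} [NormedAddCommGroup H] [InnerProductSpace ℂ H] [CompleteSpace H]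
    (W : ∀ s, T.D s →L[ℂ] (H →L[ℂ] H)) (hW : ∀ s, ‖W s‖ ≤ 1)
    (hmul : ∀ s t (a : T.D s) (b : T.D t), W (s * t) (T.fmulCLM s t a b) = W s a * W t b)
    (hstar : ∀ s (a : T.D s), W s⁻¹ ⟨T.fstar s a, T.fstar_mem a.2⟩ = star (W s a)) :
    StarRep T where
  H := H
  φ :=
    { toFun := L1.lift W 1 hW
      map_smul' := fun c x => map_smul (L1.lift W 1 hW) c x
      map_zero' := map_zero (L1.lift W 1 hW)
      map_add' := map_add (L1.lift W 1 hW)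
      map_mul' := fun x y => by
        have h : ((ContinuousLinearMap.compL ℂ T.L1 T.L1 (H →L[ℂ] H)) (L1.lift W 1 hW)).comp
            T.mulCLM =
            ((ContinuousLinearMap.compL ℂ T.L1 (H →L[ℂ] H) (H →L[ℂ] H)).flip
              (L1.lift W 1 hW)).comp
              ((ContinuousLinearMap.mul ℂ (H →L[ℂ] H)).comp (L1.lift W 1 hW)) := by
          refine L1.hom_ext fun s a => L1.hom_ext fun t b => ?_
          change L1.lift W 1 hW (T.single s a * T.single t b) =
            L1.lift W 1 hW (T.single s a) * L1.lift W 1 hW (T.single t b)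
          rw [single_mul_single, L1.lift_single, L1.lift_single, L1.lift_single, hmul]
        exact congrArg (fun f => f x y) h
      map_star' := fun x => by
        rw [L1.lift_apply, L1.lift_apply, tsum_star, ← (Equiv.inv S).tsum_eq]
        refine tsum_congr fun s => ?_
        rw [← hstar s (x.coeff s)]
        congr 1
        apply Subtype.ext
        change T.fstar s⁻¹⁻¹ (x.coeff s⁻¹⁻¹) = T.fstar s (x.coeff s)
        rw [inv_inv] }
  norm_le := fun x => by
    have := (L1.lift W 1 hW).le_of_opNorm_le (L1.norm_lift W zero_le_one hW) x
    rwa [one_mul] at this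

section Completion

variable {T} {ι : Type*} (R : ι → StarRep T)

/-- The C*-algebra of all bounded families of operators on the Hilbert spaces of the `R i`. -/
def BoundedFamilies : Type _ := lp (fun i => (R i).H →L[ℂ] (R i).H) ∞

instance : NonUnitalCStarAlgebra (BoundedFamilies R) :=
  inferInstanceAs (NonUnitalCStarAlgebra (lp (fun i => (R i).H →L[ℂ] (R i).H) ∞))

/-- All the representations `R i` at once, as a map into the C*-algebra of bounded families. -/
def repMap : T.L1 →⋆ₙₐ[ℂ] BoundedFamilies R where
  toFun x := (⟨fun i => (R i).φ x, memℓp_infty ⟨‖x‖, by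
    rintro _ ⟨i, rfl⟩
    exact (R i).norm_le x⟩⟩ : lp (fun i => (R i).H →L[ℂ] (R i).H) ∞)
  map_smul' c x := lp.ext (funext fun i => map_smul (R i).φ c x)
  map_zero' := lp.ext (funext fun i => map_zero (R i).φ)
  map_add' x y := lp.ext (funext fun i => map_add (R i).φ x y)
  map_mul' x y := lp.ext (funext fun i => map_mul (R i).φ x y)
  map_star' x := lp.ext (funext fun i => map_star (R i).φ x)

/-- The seminorm that `repMap` defines on `L1` is `‖x‖ = sup_i ‖R i x‖`. -/
theorem norm_repMap (x : T.L1) : ‖repMap R x‖ = ⨆ i, ‖(R i).φ x‖ := rfl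

/-- The Hausdorff completion of `L1` in the C*-seminorm `‖x‖ = sup_i ‖R i x‖`, realised as the
closure of the image of `L1` under `repMap R`. -/
def completion : NonUnitalStarSubalgebra ℂ (BoundedFamilies R) :=
  (NonUnitalStarAlgHom.range (repMap R)).topologicalClosure

instance : NonUnitalCStarAlgebra (completion R) :=
  NonUnitalStarSubalgebra.nonUnitalCStarAlgebra (completion R)
    (h_closed := NonUnitalStarSubalgebra.isClosed_topologicalClosure _)

end Completion

end TwistedSystem

end Convolution

/-! ### Twisted partial actions of groups and Exel's crossed product -/

section PartialActions

/-- A (discrete) twisted partial action `(α, u)` of the group `G` on the C*-algebra `A`. -/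
structure TwistedPartialAction (G A : Type*) [Group G] [NonUnitalCStarAlgebra A] where
  /-- The ideals `A_s`. -/
  D : G → NonUnitalStarSubalgebra ℂ A
  isClosedIdeal : ∀ s, IsClosedIdeal (D s)
  /-- The isomorphisms `α_s : A_{s⁻¹} → A_s`. -/
  α : ∀ s, D s⁻¹ ≃⋆ₐ[ℂ] D s
  /-- The unitary multipliers `u_{r,s}` of `A_r A_{rs}`. -/
  u : ∀ r s, 𝓜(ℂ, ↥(D r ⊓ D (r * s)))
  u_unitary : ∀ r s, u r s ∈ unitary 𝓜(ℂ, ↥(D r ⊓ D (r * s)))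
  D_one : D 1 = ⊤
  α_one : ∀ a, pmap (α 1) a = a
  /-- `α_r(A_{r⁻¹} A_s) = A_r A_{rs}`. -/
  image_inf : ∀ r s, pmap (α r) '' (D r⁻¹ ⊓ D s : NonUnitalStarSubalgebra ℂ A) =
    (D r ⊓ D (r * s) : NonUnitalStarSubalgebra ℂ A)
  /-- `α_r(α_s(a)) = u_{r,s} α_{rs}(a) u_{r,s}*` for `a ∈ A_{s⁻¹} A_{s⁻¹r⁻¹}`. -/
  comp : ∀ r s, ∀ a ∈ D s⁻¹ ⊓ D (s⁻¹ * r⁻¹),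
    pmap (α r) (pmap (α s) a) = adMul (u r s) (pmap (α (r * s)) a)
  u_one_left : ∀ t, u 1 t = 1
  u_one_right : ∀ t, u t 1 = 1
  /-- `α_r(a u_{s,t}) u_{r,st} = α_r(a) u_{r,s} u_{rs,t}` for `a ∈ A_{r⁻¹} A_s A_{st}`. -/
  cocycle : ∀ r s t, ∀ a ∈ D r⁻¹ ⊓ D s ⊓ D (s * t),
    rmul (u r (s * t)) (pmap (α r) (rmul (u s t) a)) =
      rmul (u (r * s) t) (rmul (u r s) (pmap (α r) a))

namespace TwistedPartialAction

universe u v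

/-- The data of a twisted partial action as a twisted system. The fibres `A_s δ_s` with the
products and involution of this system form the semidirect product bundle over `G`. -/
def toTwistedSystem {G A : Type*} [Group G] [NonUnitalCStarAlgebra A]
    (θ : TwistedPartialAction G A) : TwistedSystem G A where
  D := θ.D
  isClosedIdeal := θ.isClosedIdeal
  α := θ.α
  J r s := θ.D r ⊓ θ.D (r * s)
  u := θ.u
  u_unitary := θ.u_unitary
  J_le _ _ := inf_le_right
  map_mem r s a ha hb := by
    have h : pmap (θ.α r) a ∈ ((θ.D r ⊓ θ.D (r * s) : NonUnitalStarSubalgebra ℂ A) : Set A) := by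
      rw [← θ.image_inf r s]
      exact ⟨a, ⟨ha, hb⟩, rfl⟩
    exact h
  J_inv s := by rw [inv_mul_cancel, θ.D_one, inf_top_eq]

/-- Exel's crossed product `A ×_{α,u} G`: the enveloping C*-algebra of the cross sectional algebra
`L¹` of the semidirect product bundle, i.e. its Hausdorff completion in the seminorm
`‖x‖ = sup ‖φ x‖`, `φ` running through all `*`-representations on Hilbert spaces. (The universe of
the Hilbert spaces is large enough to contain all cyclic representations up to equivalence.) -/
def CrossedProduct {G : Type v} {A : Type u} [Group G] [NonUnitalCStarAlgebra A]
    (θ : TwistedPartialAction G A) : Type (max u v + 1) :=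
  TwistedSystem.completion
    (fun R : TwistedSystem.StarRep.{max u v, v, u} θ.toTwistedSystem => R)

instance {G : Type v} {A : Type u} [Group G] [NonUnitalCStarAlgebra A]
    (θ : TwistedPartialAction G A) : NonUnitalCStarAlgebra θ.CrossedProduct :=
  inferInstanceAs (NonUnitalCStarAlgebra (TwistedSystem.completion
    (fun R : TwistedSystem.StarRep.{max u v, v, u} θ.toTwistedSystem => R)))

end TwistedPartialAction

end PartialActions

/-! ### Busby–Smith twisted actions of inverse semigroups and their crossed products -/

section BusbySmith

/-- A unital inverse semigroup: every `s` has a unique `t` with `s t s = s` and `t s t = t`, which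
is denoted `s⁻¹`. (The laws of a `DivisionMonoid`, in particular `(s⁻¹)⁻¹ = s` and
`(s t)⁻¹ = t⁻¹ s⁻¹`, hold in every unital inverse semigroup.) -/
class InverseMonoid (S : Type*) extends DivisionMonoid S where
  mul_inv_mul_self : ∀ s : S, s * s⁻¹ * s = s
  eq_inv_of_mul : ∀ s t : S, s * t * s = s → t * s * t = t → t = s⁻¹

/-- A Busby–Smith twisted action `(β, w)` of the unital inverse semigroup `S` on the
C*-algebra `A`. -/
structure BusbySmithAction (S A : Type*) [InverseMonoid S] [NonUnitalCStarAlgebra A] where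
  /-- The ideals `A_s`. -/
  D : S → NonUnitalStarSubalgebra ℂ A
  isClosedIdeal : ∀ s, IsClosedIdeal (D s)
  /-- The isomorphisms `β_s : A_{s*} → A_s`. -/
  β : ∀ s, D s⁻¹ ≃⋆ₐ[ℂ] D s
  /-- The unitary multipliers `w_{s,t}` of `A_{st}`. -/
  w : ∀ s t, 𝓜(ℂ, D (s * t))
  w_unitary : ∀ s t, w s t ∈ unitary 𝓜(ℂ, D (s * t))
  D_one : D 1 = ⊤
  /-- `β_s β_t` and `Ad w_{s,t} ∘ β_{st}` have the same domain. -/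
  comp_domain : ∀ s t a, (a ∈ D t⁻¹ ∧ pmap (β t) a ∈ D s⁻¹) ↔ a ∈ D (s * t)⁻¹
  /-- `β_s β_t` and `Ad w_{s,t} ∘ β_{st}` agree on their domain. -/
  comp : ∀ s t, ∀ a ∈ D (s * t)⁻¹,
    pmap (β s) (pmap (β t) a) = adMul (w s t) (pmap (β (s * t)) a)
  w_idempotent : ∀ s t, IsIdempotentElem s ∨ IsIdempotentElem t → w s t = 1
  /-- `β_r(a w_{s,t}) w_{r,st} = β_r(a) w_{r,s} w_{rs,t}` for `a ∈ A_{r*} A_{st}`. -/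
  cocycle : ∀ r s t, ∀ a ∈ D r⁻¹ ⊓ D (s * t),
    rmul (w r (s * t)) (pmap (β r) (rmul (w s t) a)) =
      rmul (w (r * s) t) (rmul (w r s) (pmap (β r) a))

section Operators

variable {A : Type*} [NonUnitalCStarAlgebra A]
variable {H : Type*} [NormedAddCommGroup H] [InnerProductSpace ℂ H] [CompleteSpace H]

/-- The closed subspace `π(I) H`. -/
def essSubspace (π : A →⋆ₙₐ[ℂ] (H →L[ℂ] H)) (I : NonUnitalStarSubalgebra ℂ A) : Submodule ℂ H :=
  (Submodule.span ℂ {η | ∃ a ∈ I, ∃ ξ, π a ξ = η}).topologicalClosure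

instance (π : A →⋆ₙₐ[ℂ] (H →L[ℂ] H)) (I : NonUnitalStarSubalgebra ℂ A) :
    CompleteSpace (essSubspace π I) :=
  (Submodule.isClosed_topologicalClosure _).completeSpace_coe

/-- The orthogonal projection onto `π(I) H`. -/
def essProj (π : A →⋆ₙₐ[ℂ] (H →L[ℂ] H)) (I : NonUnitalStarSubalgebra ℂ A) : H →L[ℂ] H :=
  (essSubspace π I).starProjection

/-- `T = π(m)`, the canonical extension of `π` to multipliers `m` of the ideal `I`: the unique
operator with `T π(a) = π(m a)` for `a ∈ I` that vanishes on the orthogonal complement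
of `π(I) H`. -/
structure IsMultiplierImage (π : A →⋆ₙₐ[ℂ] (H →L[ℂ] H)) {I : NonUnitalStarSubalgebra ℂ A}
    (m : 𝓜(ℂ, I)) (T : H →L[ℂ] H) : Prop where
  mul_map : ∀ a ∈ I, T * π a = π (lmul m a)
  mul_essProj : T * essProj π I = T

variable (π : A →⋆ₙₐ[ℂ] (H →L[ℂ] H)) (I : NonUnitalStarSubalgebra ℂ A)

theorem essProj_mul_self : essProj π I * essProj π I = essProj π I :=
  Submodule.isIdempotentElem_starProjection _

theorem star_essProj : star (essProj π I) = essProj π I :=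
  (isSelfAdjoint_starProjection _).star_eq

variable {I}

theorem essProj_mul_map {a : A} (ha : a ∈ I) : essProj π I * π a = π a := by
  ext ξ
  exact Submodule.starProjection_eq_self_iff.2
    (Submodule.le_topologicalClosure _ (Submodule.subset_span ⟨a, ha, ξ, rfl⟩))

theorem map_mul_essProj {a : A} (ha : a ∈ I) : π a * essProj π I = π a := by
  have h := congrArg star (essProj_mul_map π (star_mem ha : star a ∈ I))
  rwa [star_mul, star_essProj, map_star, star_star] at h

theorem mul_essProj_ext {X Y : H →L[ℂ] H} (h : ∀ a ∈ I, X * π a = Y * π a) :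
    X * essProj π I = Y * essProj π I := by
  have hle : essSubspace π I ≤ LinearMap.ker ((X - Y : H →L[ℂ] H) : H →ₗ[ℂ] H) := by
    refine Submodule.topologicalClosure_minimal _ ?_ (X - Y).isClosed_ker
    rw [Submodule.span_le]
    rintro _ ⟨a, ha, ξ, rfl⟩
    have := congrArg (fun f : H →L[ℂ] H => f ξ) (h a ha)
    simpa [sub_eq_zero] using! this
  ext ξ
  have := hle (Submodule.starProjection_apply_mem (essSubspace π I) ξ)
  simpa [sub_eq_zero] using! this

theorem IsMultiplierImage.map_mul {m : 𝓜(ℂ, I)} {T : H →L[ℂ] H} (hT : IsMultiplierImage π m T)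
    {a : A} (ha : a ∈ I) : π a * T = π (rmul m a) := by
  rw [← hT.mul_essProj, ← mul_assoc, ← map_mul_essProj π (rmul_mem m ha)]
  refine mul_essProj_ext π fun x hx => ?_
  rw [mul_assoc, hT.mul_map x hx, ← _root_.map_mul, ← _root_.map_mul, rmul_mul m ha hx]

end Operators

namespace BusbySmithAction

universe u v

variable {S : Type v} {A : Type u} [InverseMonoid S] [NonUnitalCStarAlgebra A]

theorem map_mem (b : BusbySmithAction S A) (s t : S) (a : A) (ha : a ∈ b.D s⁻¹) (hb : a ∈ b.D t) :
    pmap (b.β s) a ∈ b.D (s * t) := by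
  have h1 : pmap (b.β t).symm a ∈ b.D (s * t)⁻¹ := by
    rw [← b.comp_domain s t, pmap_pmap_symm _ hb]
    exact ⟨pmap_mem _ hb, ha⟩
  have h2 := b.comp s t _ h1
  rw [pmap_pmap_symm _ hb] at h2
  rw [h2]
  exact adMul_mem _ (pmap_mem _ h1)

theorem D_inv_mul (b : BusbySmithAction S A) (s : S) : b.D (s⁻¹ * s) = b.D s⁻¹ := by
  apply le_antisymm
  · intro a ha
    have h : (s⁻¹ * s)⁻¹ = s⁻¹ * s := by rw [mul_inv_rev, inv_inv]
    rw [← h, ← b.comp_domain] at ha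
    exact ha.1
  · intro a ha
    have h1 : pmap (b.β s⁻¹).symm a ∈ b.D s⁻¹⁻¹ := pmap_mem _ ha
    have h2 := b.map_mem s⁻¹ s _ h1 ((congrArg b.D (inv_inv s)).le h1)
    rwa [pmap_pmap_symm _ ha] at h2

/-- The data of a Busby–Smith twisted action as a twisted system. -/
def toTwistedSystem (b : BusbySmithAction S A) : TwistedSystem S A where
  D := b.D
  isClosedIdeal := b.isClosedIdeal
  α := b.β
  J s t := b.D (s * t)
  u := b.w
  u_unitary := b.w_unitary
  J_le _ _ := le_rfl
  map_mem := b.map_mem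
  J_inv := b.D_inv_mul

/-- A covariant representation `(π, V, H)` of a Busby–Smith twisted action. -/
structure CovariantRep.{x, y, z} {S : Type y} {A : Type z} [InverseMonoid S]
    [NonUnitalCStarAlgebra A] (b : BusbySmithAction S A) where
  H : Type x
  [normedAddCommGroup : NormedAddCommGroup H]
  [innerProductSpace : InnerProductSpace ℂ H]
  [completeSpace : CompleteSpace H]
  π : A →⋆ₙₐ[ℂ] (H →L[ℂ] H)
  nondegenerate : essSubspace π ⊤ = ⊤
  V : S → (H →L[ℂ] H)
  /-- `V_s` is a partial isometry with initial space `π(A_{s*}) H`. -/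
  initial : ∀ s, star (V s) * V s = essProj π (b.D s⁻¹)
  /-- `V_s` is a partial isometry with final space `π(A_s) H`. -/
  final : ∀ s, V s * star (V s) = essProj π (b.D s)
  /-- `V_r V_s = π(w_{r,s}) V_{rs}`. -/
  mul : ∀ r s, ∃ T, IsMultiplierImage π (b.w r s) T ∧ V r * V s = T * V (r * s)
  /-- `π(β_s(a)) = V_s π(a) V_s*` for `a ∈ A_{s*}`. -/
  covariant : ∀ s, ∀ a ∈ b.D s⁻¹, π (pmap (b.β s) a) = V s * π a * star (V s)

attribute [instance] CovariantRep.normedAddCommGroup CovariantRep.innerProductSpace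
  CovariantRep.completeSpace

namespace CovariantRep

variable {b : BusbySmithAction S A} (ρ : CovariantRep b)

theorem norm_V_le (s : S) : ‖ρ.V s‖ ≤ 1 := by
  have h1 : ‖ρ.V s‖ * ‖ρ.V s‖ = ‖essProj ρ.π (b.D s⁻¹)‖ := by
    rw [← ρ.initial s, CStarRing.norm_star_mul_self]
  have h2 : ‖essProj ρ.π (b.D s⁻¹)‖ ≤ 1 := Submodule.starProjection_norm_le _
  nlinarith [norm_nonneg (ρ.V s)]

theorem V_mul_essProj (s : S) : ρ.V s * essProj ρ.π (b.D s⁻¹) = ρ.V s := by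
  have h : star (ρ.V s * essProj ρ.π (b.D s⁻¹) - ρ.V s) *
      (ρ.V s * essProj ρ.π (b.D s⁻¹) - ρ.V s) = 0 := by
    have hP := essProj_mul_self ρ.π (b.D s⁻¹)
    simp only [star_sub, star_mul, star_essProj, sub_mul, mul_sub]
    simp only [mul_assoc, ← mul_assoc (star (ρ.V s)), ρ.initial s, hP]
    simp
  exact sub_eq_zero.1 (CStarRing.star_mul_self_eq_zero_iff _ |>.1 h)

theorem essProj_mul_V (s : S) : essProj ρ.π (b.D s) * ρ.V s = ρ.V s := by
  rw [← ρ.final s, mul_assoc, ρ.initial s, V_mul_essProj]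

/-- `π(β_s(k)) V_s = V_s π(k)` for `k ∈ A_{s*}`. -/
theorem map_mul_V {s : S} {k : A} (hk : k ∈ b.D s⁻¹) :
    ρ.π (pmap (b.β s) k) * ρ.V s = ρ.V s * ρ.π k := by
  rw [ρ.covariant s k hk, mul_assoc, ρ.initial, mul_assoc, map_mul_essProj ρ.π hk]

theorem star_V_mul_map {s : S} {k : A} (hk : k ∈ b.D s⁻¹) :
    star (ρ.V s) * ρ.π (pmap (b.β s) k) = ρ.π k * star (ρ.V s) := by
  rw [ρ.covariant s k hk, ← mul_assoc, ← mul_assoc, ρ.initial, essProj_mul_map ρ.π hk]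

theorem map_mul_V_mul_V {s t : S} {k : A} (hk : k ∈ b.D (s * t)) :
    ρ.π k * (ρ.V s * ρ.V t) = ρ.π (rmul (b.w s t) k) * ρ.V (s * t) := by
  obtain ⟨T, hT, h⟩ := ρ.mul s t
  rw [h, ← mul_assoc, hT.map_mul ρ.π hk]

theorem integrated_mul {s t : S} {x y : A} (hx : x ∈ b.D s) (hy : y ∈ b.D t) :
    ρ.π (b.toTwistedSystem.fmul s t x y) * ρ.V (s * t) =
      ρ.π x * ρ.V s * (ρ.π y * ρ.V t) := by
  have h : pmap (b.β s).symm x * y ∈ b.D s⁻¹ := (b.toTwistedSystem.inner_mem hx hy).1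
  have hJ : pmap (b.β s) (pmap (b.β s).symm x * y) ∈ b.D (s * t) :=
    b.toTwistedSystem.fmul_mem_J hx hy
  change ρ.π (rmul (b.w s t) (pmap (b.β s) (pmap (b.β s).symm x * y))) * ρ.V (s * t) = _
  rw [← ρ.map_mul_V_mul_V hJ, ← mul_assoc, ρ.map_mul_V h, _root_.map_mul]
  have h2 := ρ.map_mul_V (pmap_mem (b.β s).symm hx)
  rw [pmap_pmap_symm _ hx] at h2
  rw [← mul_assoc, ← h2]
  simp only [mul_assoc]

theorem V_idempotent {e : S} (he : IsIdempotentElem e) (he' : e⁻¹ = e) :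
    ρ.V e = essProj ρ.π (b.D e) := by
  obtain ⟨T, hT, h⟩ := ρ.mul e e
  have hw := b.w_idempotent e e (Or.inl he)
  have hT1 : T = essProj ρ.π (b.D (e * e)) := by
    rw [← hT.mul_essProj]
    nth_rewrite 2 [← one_mul (essProj ρ.π (b.D (e * e)))]
    refine mul_essProj_ext ρ.π fun a ha => ?_
    rw [hT.mul_map a ha, hw, one_mul]
    congr 1
    lift a to b.D (e * e) using ha
    rw [lmul_coe]; rfl
  have hee : e * e = e := he
  rw [hT1, hee, essProj_mul_V] at h
  have hi := ρ.initial e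
  have hP := ρ.essProj_mul_V e
  rw [he'] at hi
  rw [← hi, mul_assoc, h, hi] at hP
  exact hP.symm

theorem V_inv (s : S) : ∃ T, IsMultiplierImage ρ.π (b.w s⁻¹ s) T ∧
    ρ.V s⁻¹ = T * star (ρ.V s) := by
  obtain ⟨T, hT, h⟩ := ρ.mul s⁻¹ s
  refine ⟨T, hT, ?_⟩
  have he : IsIdempotentElem (s⁻¹ * s) := by
    have := InverseMonoid.mul_inv_mul_self s
    rw [IsIdempotentElem, mul_assoc, ← mul_assoc s, this]
  rw [ρ.V_idempotent he (by rw [mul_inv_rev, inv_inv]), hT.mul_essProj] at h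
  have h2 := ρ.V_mul_essProj s⁻¹
  rw [inv_inv] at h2
  rw [← h, mul_assoc, ρ.final, h2]

theorem integrated_star {s : S} {x : A} (hx : x ∈ b.D s) :
    ρ.π (b.toTwistedSystem.fstar s x) * ρ.V s⁻¹ = star (ρ.π x * ρ.V s) := by
  obtain ⟨T, hT, h⟩ := ρ.V_inv s
  have hk : pmap (b.β s).symm (star x) ∈ b.D s⁻¹ := pmap_mem _ (star_mem hx)
  have hk' : pmap (b.β s).symm (star x) ∈ b.D (s⁻¹ * s) := (b.D_inv_mul s).ge hk
  change ρ.π (rmul (star (b.w s⁻¹ s)) (pmap (b.β s).symm (star x))) * ρ.V s⁻¹ = _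
  rw [h, ← mul_assoc, hT.map_mul ρ.π (rmul_mem _ hk'),
    rmul_rmul_star (b.w_unitary _ _) hk', ← ρ.star_V_mul_map hk, pmap_pmap_symm _ (star_mem hx),
    star_mul, map_star]

/-- The integrated form `(π × V)(x) = ∑ s, π(x(s)) V_s`. -/
def integratedForm : b.toTwistedSystem.StarRep :=
  TwistedSystem.StarRep.ofFamily (T := b.toTwistedSystem) (H := ρ.H)
    (fun s => LinearMap.mkContinuous
      { toFun := fun a => ρ.π a * ρ.V s
        map_add' := fun a c => by rw [AddMemClass.coe_add, map_add, add_mul]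
        map_smul' := fun c a => by
          rw [SetLike.val_smul, map_smul, smul_mul_assoc, RingHom.id_apply] } 1
      fun a => by
        have h1 := NonUnitalStarAlgHom.norm_apply_le ρ.π (a : A)
        have h2 := ρ.norm_V_le s
        calc ‖ρ.π (a : A) * ρ.V s‖ ≤ ‖ρ.π (a : A)‖ * ‖ρ.V s‖ := norm_mul_le _ _
          _ ≤ ‖(a : A)‖ * 1 := by gcongr
          _ = 1 * ‖a‖ := by rw [mul_one, one_mul]; rfl)
    (fun s => LinearMap.mkContinuous_norm_le _ zero_le_one _)
    (fun _ _ x y => ρ.integrated_mul x.2 y.2)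
    (fun _ x => ρ.integrated_star x.2)

end CovariantRep

/-- The crossed product `A ×_{β,w} S`: the Hausdorff completion of the Banach `*`-algebra
`{x ∈ ℓ¹(S, A) | x(s) ∈ A_s for all s}` in the seminorm `‖x‖ = sup ‖(π × V)(x)‖`, `(π, V)` running
through all covariant representations on Hilbert spaces. (The universe of the Hilbert spaces is
large enough to contain all cyclic representations up to equivalence.) -/
def CrossedProduct (b : BusbySmithAction S A) : Type (max u v + 1) :=
  TwistedSystem.completion
    (fun ρ : CovariantRep.{max u v, v, u} b => ρ.integratedForm)

instance (b : BusbySmithAction S A) : NonUnitalCStarAlgebra b.CrossedProduct :=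
  inferInstanceAs (NonUnitalCStarAlgebra (TwistedSystem.completion
    (fun ρ : CovariantRep.{max u v, v, u} b => ρ.integratedForm)))

end BusbySmithAction

end BusbySmith

/-! ### The inverse semigroup of a group and the corresponding twisted action -/

section ExelSemigroup

/-- The inverse semigroup `S(G)` associated with the group `G`, through canonical forms:
`[g₁][g₁⁻¹] ⋯ [gₘ][gₘ⁻¹][s]` is represented by `elt = s` and the finite set
`supp = {1, s, g₁, …, gₘ}` (the order of the idempotents `[gᵢ][gᵢ⁻¹]` is irrelevant, repetitions
can be dropped, `[1][1⁻¹] = [1]` is the unit and `[s][s⁻¹][s] = [s]`). -/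
@[ext]
structure ExelSemigroup (G : Type*) [Group G] where
  supp : Finset G
  elt : G
  one_mem : 1 ∈ supp
  elt_mem : elt ∈ supp

namespace ExelSemigroup

variable {G : Type*} [Group G]

open Classical in
/-- The element `[g₁][g₁⁻¹] ⋯ [gₘ][gₘ⁻¹][s]` for the list `l = [g₁, …, gₘ]`. -/
def ofCanonical (l : List G) (s : G) : ExelSemigroup G where
  supp := insert 1 (insert s l.toFinset)
  elt := s
  one_mem := by simp
  elt_mem := by simp

open Classical in
/-- The product of `[g₁][g₁⁻¹] ⋯ [gₘ][gₘ⁻¹][s]` and `[h₁][h₁⁻¹] ⋯ [hₙ][hₙ⁻¹][t]` is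
`[g₁][g₁⁻¹] ⋯ [gₘ][gₘ⁻¹] [s][s⁻¹] [sh₁][(sh₁)⁻¹] ⋯ [shₙ][(shₙ)⁻¹] [st]`. -/
instance : Mul (ExelSemigroup G) :=
  ⟨fun p q => ⟨p.supp ∪ q.supp.image (p.elt * ·), p.elt * q.elt,
    Finset.mem_union_left _ p.one_mem,
    Finset.mem_union_right _ (Finset.mem_image_of_mem _ q.elt_mem)⟩⟩

/-- The unit `[1]`. -/
instance : One (ExelSemigroup G) :=
  ⟨⟨{1}, 1, Finset.mem_singleton_self 1, Finset.mem_singleton_self 1⟩⟩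

open Classical in
/-- `([g₁][g₁⁻¹] ⋯ [gₘ][gₘ⁻¹][s])* = [s⁻¹gₘ][(s⁻¹gₘ)⁻¹] ⋯ [s⁻¹g₁][(s⁻¹g₁)⁻¹][s⁻¹]`. -/
instance : Inv (ExelSemigroup G) :=
  ⟨fun p => ⟨p.supp.image (p.elt⁻¹ * ·), p.elt⁻¹,
    Finset.mem_image.2 ⟨p.elt, p.elt_mem, inv_mul_cancel _⟩,
    Finset.mem_image.2 ⟨1, p.one_mem, mul_one _⟩⟩⟩

theorem mul_elt (p q : ExelSemigroup G) : (p * q).elt = p.elt * q.elt := rfl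

theorem inv_elt (p : ExelSemigroup G) : p⁻¹.elt = p.elt⁻¹ := rfl

theorem one_elt : (1 : ExelSemigroup G).elt = 1 := rfl

theorem mem_mul_supp {p q : ExelSemigroup G} {g : G} :
    g ∈ (p * q).supp ↔ g ∈ p.supp ∨ p.elt⁻¹ * g ∈ q.supp := by
  classical
  change g ∈ p.supp ∪ q.supp.image (p.elt * ·) ↔ _
  rw [Finset.mem_union, Finset.mem_image]
  refine or_congr_right ⟨?_, fun h => ⟨_, h, mul_inv_cancel_left _ _⟩⟩
  rintro ⟨h, hh, rfl⟩
  rwa [inv_mul_cancel_left]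

theorem mem_inv_supp {p : ExelSemigroup G} {g : G} : g ∈ p⁻¹.supp ↔ p.elt * g ∈ p.supp := by
  classical
  change g ∈ p.supp.image (p.elt⁻¹ * ·) ↔ _
  rw [Finset.mem_image]
  refine ⟨?_, fun h => ⟨_, h, inv_mul_cancel_left _ _⟩⟩
  rintro ⟨h, hh, rfl⟩
  rwa [mul_inv_cancel_left]

theorem mem_one_supp {g : G} : g ∈ (1 : ExelSemigroup G).supp ↔ g = 1 := Finset.mem_singleton

theorem ext_iff' {p q : ExelSemigroup G} :
    p = q ↔ p.elt = q.elt ∧ ∀ g, g ∈ p.supp ↔ g ∈ q.supp := by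
  rw [ExelSemigroup.ext_iff, Finset.ext_iff, and_comm]

instance : InverseMonoid (ExelSemigroup G) where
  mul_assoc p q r := by
    simp only [ext_iff', mul_elt, mem_mul_supp, mul_inv_rev, mul_assoc, or_assoc, and_self,
      implies_true]
  one_mul p := by
    simp only [ext_iff', mul_elt, mem_mul_supp, one_elt, mem_one_supp, one_mul, inv_one, true_and]
    exact fun g => or_iff_right_of_imp fun h => h ▸ p.one_mem
  mul_one p := by
    simp only [ext_iff', mul_elt, mem_mul_supp, one_elt, mem_one_supp, mul_one, true_and]
    exact fun g => or_iff_left_of_imp fun h => (inv_mul_eq_one.1 h) ▸ p.elt_mem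
  inv_inv p := by
    simp only [ext_iff', inv_elt, mem_inv_supp, inv_inv, mul_inv_cancel_left, implies_true,
      and_self]
  mul_inv_rev p q := by
    simp only [ext_iff', mul_elt, inv_elt, mem_mul_supp, mem_inv_supp, mul_inv_rev, inv_inv,
      mul_assoc, inv_mul_cancel_left, true_and]
    exact fun g => or_comm
  inv_eq_of_mul p q h := by
    rw [ext_iff'] at h
    simp only [mul_elt, one_elt, mem_mul_supp, mem_one_supp] at h
    have hp : p.elt = 1 := (h.2 _).1 (Or.inl p.elt_mem)
    have hq : q.elt = 1 := by simpa [hp] using h.1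
    simp only [ext_iff', inv_elt, mem_inv_supp, hp, hq, inv_one, one_mul, true_and]
    have h1 : ∀ g, g ∈ p.supp → g = 1 := fun g hg => (h.2 g).1 (Or.inl hg)
    have h2 : ∀ g, g ∈ q.supp → g = 1 := fun g hg => (h.2 g).1 (Or.inr (by simpa [hp] using hg))
    exact fun g => ⟨fun hg => h1 g hg ▸ q.one_mem, fun hg => h2 g hg ▸ p.one_mem⟩
  mul_inv_mul_self p := by
    simp only [ext_iff', mul_elt, inv_elt, mem_mul_supp, mem_inv_supp, mul_inv_cancel, one_mul,
      inv_one, mul_inv_cancel_left, or_self, implies_true, and_self]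
  eq_inv_of_mul p q h1 h2 := by
    rw [ext_iff'] at h1 h2
    simp only [mul_elt, mem_mul_supp] at h1 h2
    have hq : q.elt = p.elt⁻¹ :=
      eq_inv_of_mul_eq_one_right (mul_eq_right.1 h1.1)
    rw [ext_iff']
    refine ⟨hq, fun g => ?_⟩
    rw [mem_inv_supp]
    constructor
    · intro hg
      exact (h1.2 _).1 (Or.inl (Or.inr (by rwa [inv_mul_cancel_left])))
    · intro hg
      exact (h2.2 _).1 (Or.inl (Or.inr (by rwa [hq, inv_inv])))

/-- The generator `[g]`. -/
def of (g : G) : ExelSemigroup G := ofCanonical [] g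

/-- `ofCanonical [g₁, …, gₘ] s = [g₁][g₁⁻¹] ⋯ [gₘ][gₘ⁻¹][s]`. -/
theorem ofCanonical_cons (g : G) (l : List G) (s : G) :
    ofCanonical (g :: l) s = of g * of g⁻¹ * ofCanonical l s := by
  classical
  rw [ext_iff']
  refine ⟨by simp [of, ofCanonical, mul_elt], fun h => ?_⟩
  rw [mem_mul_supp, mem_mul_supp]
  simp only [of, ofCanonical, mul_elt, List.toFinset_cons, List.toFinset_nil, Finset.mem_insert,
    List.mem_toFinset, Finset.notMem_empty, or_false, mul_inv_cancel, inv_one, one_mul,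
    inv_mul_eq_one, mul_eq_left]
  grind

/-- Every element of `S(G)` has a canonical form. -/
theorem exists_canonical (p : ExelSemigroup G) : ∃ l : List G, p = ofCanonical l p.elt := by
  classical
  refine ⟨p.supp.toList, ?_⟩
  rw [ext_iff']
  refine ⟨rfl, fun g => ?_⟩
  simp only [ofCanonical, Finset.mem_insert, List.mem_toFinset, Finset.mem_toList]
  refine ⟨fun h => Or.inr (Or.inr h), ?_⟩
  rintro (rfl | rfl | h)
  exacts [p.one_mem, p.elt_mem, h]

end ExelSemigroup

/-- The Busby–Smith twisted action `(β, w)` of `S(G)` on `A` corresponds to the twisted partial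
action `(α, u)` of `G` on `A`: for `p = [g₁][g₁⁻¹] ⋯ [gₘ][gₘ⁻¹][s]` and
`q = [h₁][h₁⁻¹] ⋯ [hₙ][hₙ⁻¹][t]`
* `A_p = A_{g₁} ⋯ A_{gₘ} A_s`,
* `β_p = α_{g₁} α_{g₁}⁻¹ ⋯ α_{gₘ} α_{gₘ}⁻¹ α_s`, which is the restriction of `α_s` to the domain
  `A_{p*}` of `β_p` because `α_g α_g⁻¹` is the identity map of `A_g`,
* `w_{p,q} = 1_{M(A_{pq})} u_{s,t}`, i.e. `w_{p,q}` is the restriction of `u_{s,t}` to `A_{pq}`. -/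
structure BusbySmithAction.Corresponds {G A : Type*} [Group G] [NonUnitalCStarAlgebra A]
    (b : BusbySmithAction (ExelSemigroup G) A) (θ : TwistedPartialAction G A) : Prop where
  D_eq : ∀ p : ExelSemigroup G, b.D p = ⨅ g ∈ p.supp, θ.D g
  β_eq : ∀ p : ExelSemigroup G, ∀ a ∈ b.D p⁻¹, pmap (b.β p) a = pmap (θ.α p.elt) a
  lmul_w : ∀ p q : ExelSemigroup G, ∀ a ∈ b.D (p * q),
    lmul (b.w p q) a = lmul (θ.u p.elt q.elt) a
  rmul_w : ∀ p q : ExelSemigroup G, ∀ a ∈ b.D (p * q),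
    rmul (b.w p q) a = rmul (θ.u p.elt q.elt) a

end ExelSemigroup

end

/-!
The convolution algebra of `S(G)` maps onto that of `G` by `a δ_p ↦ a δ_{p.elt}`, because by the
correspondence the fibres, products and involution of `(β, w)` are restrictions of those of
`(α, u)`, and `A_{[s]} = A_s` (`BusbySmithAction.Corresponds.isMorphism`,
`TwistedSystem.IsMorphism.push_surjective`). Two dense images of the same `*`-algebra carrying the
same C*-seminorm have isomorphic completions (`nonempty_closure_range_equiv`), so it remains to
compare the seminorms.

* The integrated form of a covariant representation `(π, V)` of `S(G)` factors through `L¹` of the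
  group: every `p` with `p.elt = s` is `e [s]` for the idempotent `e = p p*`, and `V_e` is the
  projection onto `π(A_e) H`, so `π(a) V_p = π(a) V_{[s]}` for `a ∈ A_p`
  (`BusbySmithAction.Corresponds.exists_starRep`).
* A representation `φ` of `L¹` of the group, pulled back to `S(G)`, satisfies `φ(a δ_e) = φ(a δ_1)`
  for idempotents `e`, as these lie over the unit of `G`. For a Busby–Smith twisted action of any
  unital inverse semigroup this property makes `φ` disintegrate: with `π(a) = φ(a δ_1)`, the
  identity `(β_p(a) δ_p)* (β_p(c) δ_p) = a* c δ_{p*p}` gives an isometry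
  `π(a) ξ ↦ φ(β_p(a) δ_p) ξ` of `π(A_{p*}) H`, and its extension by zero is the partial isometry
  `V_p`. It has final space `π(A_p) H` because `(c δ_p) (d δ_p)* = c d* δ_{pp*}`. The same
  identities show that `φ` vanishes off the essential subspace of `π`, so restricting to this
  subspace makes `π` nondegenerate without changing norms
  (`BusbySmithAction.IdentifiesIdempotents.exists_norm_le`).
-/

noncomputable section

/-! ### Completions in equal seminorms -/

section Closure

variable {X B C : Type*} [NonUnitalNonAssocSemiring X] [Module ℂ X] [Star X]
  [NonUnitalCStarAlgebra B] [NonUnitalCStarAlgebra C]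

/-- A continuous `*`-homomorphism that is isometric on the closure of the range of `k` maps this
closure onto the closure of the image. -/
theorem nonempty_closure_range_equiv_of_isometric (k : X →⋆ₙₐ[ℂ] B) (p : B →⋆ₙₐ[ℂ] C)
    (hp : Continuous p)
    (h : ∀ y ∈ (NonUnitalStarAlgHom.range k).topologicalClosure, ‖p y‖ = ‖y‖) :
    Nonempty ((NonUnitalStarAlgHom.range k).topologicalClosure ≃⋆ₐ[ℂ]
      (NonUnitalStarAlgHom.range (p.comp k)).topologicalClosure) := by
  set E := (NonUnitalStarAlgHom.range k).topologicalClosure with hE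
  set F := (NonUnitalStarAlgHom.range (p.comp k)).topologicalClosure with hF
  have hEc : IsClosed (E : Set B) := NonUnitalStarSubalgebra.isClosed_topologicalClosure _
  have := hEc.completeSpace_coe
  have hmem : ∀ y : E, p y ∈ F := by
    intro y
    refine map_mem_closure hp y.2 ?_
    rintro _ ⟨x, rfl⟩
    exact ⟨x, rfl⟩
  let q : E →⋆ₙₐ[ℂ] C := p.comp (NonUnitalStarSubalgebraClass.subtype E)
  have hq : Isometry q := AddMonoidHomClass.isometry_of_norm q fun y => h y y.2
  have hsurj : ∀ z ∈ F, ∃ y : E, p y = z := by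
    have hcl : IsClosed (Set.range q) := hq.isClosedEmbedding.isClosed_range
    have hle : (F : Set C) ⊆ Set.range q := by
      refine closure_minimal ?_ hcl
      rintro _ ⟨x, rfl⟩
      exact ⟨⟨k x, NonUnitalStarSubalgebra.le_topologicalClosure _ ⟨x, rfl⟩⟩, rfl⟩
    exact fun z hz => hle hz
  refine ⟨StarAlgEquiv.ofBijective (NonUnitalStarAlgHom.codRestrict q F hmem)
    ⟨(NonUnitalStarAlgHom.injective_codRestrict q F hmem).2 hq.injective, ?_⟩⟩
  rintro ⟨z, hz⟩
  obtain ⟨y, hy⟩ := hsurj z hz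
  exact ⟨y, Subtype.ext hy⟩

/-- Two `*`-homomorphisms that define the same seminorm have isomorphic closed ranges: both are
isometric images of the closure of the graph `{(f x, g x)}`. -/
theorem nonempty_closure_range_equiv (f : X →⋆ₙₐ[ℂ] B) (g : X →⋆ₙₐ[ℂ] C)
    (h : ∀ x, ‖f x‖ = ‖g x‖) :
    Nonempty ((NonUnitalStarAlgHom.range f).topologicalClosure ≃⋆ₐ[ℂ]
      (NonUnitalStarAlgHom.range g).topologicalClosure) := by
  have hfg : ∀ y ∈ (NonUnitalStarAlgHom.range (f.prod g)).topologicalClosure, ‖y.1‖ = ‖y.2‖ := by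
    intro y hy
    have hcl : IsClosed {y : B × C | ‖y.1‖ = ‖y.2‖} :=
      isClosed_eq continuous_fst.norm continuous_snd.norm
    refine closure_minimal (t := {y : B × C | ‖y.1‖ = ‖y.2‖}) ?_ hcl hy
    rintro _ ⟨x, rfl⟩
    exact h x
  obtain ⟨e₁⟩ := nonempty_closure_range_equiv_of_isometric (f.prod g)
    (NonUnitalStarAlgHom.fst ℂ B C) continuous_fst fun y hy => by
      rw [Prod.norm_def, ← hfg y hy, max_self]; rfl
  obtain ⟨e₂⟩ := nonempty_closure_range_equiv_of_isometric (f.prod g)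
    (NonUnitalStarAlgHom.snd ℂ B C) continuous_snd fun y hy => by
      rw [Prod.norm_def, hfg y hy, max_self]; rfl
  exact ⟨e₁.symm.trans e₂⟩

end Closure

/-! ### Multipliers of closed ideals -/

section Multipliers

variable {A : Type*} [NonUnitalCStarAlgebra A] {I J : NonUnitalStarSubalgebra ℂ A}

theorem lmul_one {a : A} (ha : a ∈ I) : lmul (1 : 𝓜(ℂ, I)) a = a := by
  lift a to I using ha
  rw [lmul_coe]; rfl

theorem rmul_one {a : A} (ha : a ∈ I) : rmul (1 : 𝓜(ℂ, I)) a = a := by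
  lift a to I using ha
  rw [rmul_coe]; rfl

theorem star_rmul_star (m : 𝓜(ℂ, I)) {a : A} (ha : a ∈ I) :
    star (rmul (star m) a) = lmul m (star a) := by
  lift a to I using ha
  rw [rmul_coe, ← StarMemClass.coe_star, ← StarMemClass.coe_star, lmul_coe,
    DoubleCentralizer.star_snd, star_star]

theorem star_lmul (m : 𝓜(ℂ, I)) {a : A} (ha : a ∈ I) :
    star (lmul m a) = rmul (star m) (star a) := by
  rw [eq_comm, ← star_inj, star_star, star_rmul_star m (star_mem ha), star_star]

/-- A unitary multiplier preserves the `A`-valued inner product `(a, c) ↦ a* c` of the ideal. -/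
theorem star_lmul_mul_lmul {m : 𝓜(ℂ, I)} (hm : m ∈ unitary 𝓜(ℂ, I)) {a c : A} (ha : a ∈ I)
    (hc : c ∈ I) : star (lmul m a) * lmul m c = star a * c := by
  rw [star_lmul m ha, ← rmul_mul m (rmul_mem _ (star_mem ha)) hc,
    rmul_rmul_star hm (star_mem ha)]

/-- `(d x) m = d (x m)` for `x` in the closed ideal `I` and any `d`: the difference lies in `I` and
annihilates `I`, in particular its own adjoint. -/
theorem rmul_mul_left (hI : IsClosedIdeal I) (m : 𝓜(ℂ, I)) (d : A) {x : A} (hx : x ∈ I) :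
    rmul m (d * x) = d * rmul m x := by
  have hdx := hI.mul_mem_left d hx
  set z := rmul m (d * x) - d * rmul m x with hz
  have hzI : z ∈ I := sub_mem (rmul_mem m hdx) (hI.mul_mem_left d (rmul_mem m hx))
  have h0 : z * star z = 0 := by
    have hs : star z ∈ I := star_mem hzI
    conv_lhs => rw [hz]
    rw [sub_mul, rmul_mul m hdx hs, mul_assoc d (rmul m x), rmul_mul m hx hs, ← mul_assoc, sub_self]
  exact sub_eq_zero.1 ((CStarRing.mul_star_self_eq_zero_iff z).1 h0)

theorem star_pmap (f : I ≃⋆ₐ[ℂ] J) {a : A} (ha : a ∈ I) : pmap f (star a) = star (pmap f a) := by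
  lift a to I using ha
  rw [← StarMemClass.coe_star, pmap_coe, pmap_coe, map_star, StarMemClass.coe_star]

end Multipliers

/-! ### Operators on essential subspaces -/

section EssentialSubspaces

variable {A : Type*} [NonUnitalCStarAlgebra A]
variable {H : Type*} [NormedAddCommGroup H] [InnerProductSpace ℂ H] [CompleteSpace H]

/-- `Q X = X` as soon as `Q X X* = X X*`: the latter forces `(Q X - X) (Q X - X)* = 0`. -/
theorem mul_eq_self_of_mul_star {Q X : H →L[ℂ] H}
    (h : Q * (X * star X) = X * star X) : Q * X = X := by
  have h0 : (Q * X - X) * star (Q * X - X) = 0 := by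
    have : (Q * X - X) * star (Q * X - X) = (Q * (X * star X) - X * star X) * star (Q - 1) := by
      simp only [star_sub, star_mul, star_one]
      noncomm_ring
    rw [this, h, sub_self, zero_mul]
  exact sub_eq_zero.1 ((CStarRing.mul_star_self_eq_zero_iff _).1 h0)

theorem mul_eq_self_of_star_mul {Q X : H →L[ℂ] H} (hQ : star Q = Q)
    (h : star X * X * Q = star X * X) : X * Q = X := by
  have h1 := congrArg star h
  rw [star_mul, star_mul, star_star, hQ] at h1
  have h2 := mul_eq_self_of_mul_star (Q := Q) (X := star X) (by rw [star_star]; exact h1)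
  have h3 := congrArg star h2
  rwa [star_mul, star_star, hQ] at h3

variable (π : A →⋆ₙₐ[ℂ] (H →L[ℂ] H)) {I J : NonUnitalStarSubalgebra ℂ A}

theorem essProj_mul_ext {X Y : H →L[ℂ] H} (h : ∀ a ∈ I, π a * X = π a * Y) :
    essProj π I * X = essProj π I * Y := by
  have h1 := mul_essProj_ext π (I := I) (X := star X) (Y := star Y) fun a ha => by
    have h2 := congrArg star (h (star a) (star_mem ha))
    rwa [star_mul, star_mul, ← map_star, star_star] at h2
  have h3 := congrArg star h1
  rwa [star_mul, star_mul, star_essProj, star_star, star_star] at h3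

theorem essProj_mul_essProj_of_le (h : I ≤ J) : essProj π J * essProj π I = essProj π I := by
  conv_rhs => rw [← one_mul (essProj π I)]
  refine mul_essProj_ext π fun a ha => ?_
  rw [essProj_mul_map π (h ha), one_mul]

theorem essProj_mul_essProj_of_le' (h : I ≤ J) : essProj π I * essProj π J = essProj π I := by
  have h1 := congrArg star (essProj_mul_essProj_of_le π h)
  rwa [star_mul, star_essProj, star_essProj] at h1

/-- The projection onto `π(I) H` commutes with `π(A)`. -/
theorem essProj_mul_map_comm (hI : IsClosedIdeal I) (a : A) :
    essProj π I * π a = π a * essProj π I := by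
  have h : ∀ a : A, essProj π I * π a * essProj π I = π a * essProj π I := fun a =>
    mul_essProj_ext π fun c hc => by
      rw [mul_assoc, ← _root_.map_mul, essProj_mul_map π (hI.mul_mem_left a hc)]
  have h1 := congrArg star (h (star a))
  simp only [star_mul, star_essProj, ← map_star, star_star] at h1
  rw [← h1, ← mul_assoc, h a]

/-- A map `F` on `I` with `F(a)* F(c) = π(a* c)` is given by a partial isometry `V` with initial
space `π(I) H`, as `F(a) = V π(a)`. On finite sums, `V` maps `∑ π(aᵢ) ξᵢ` to `∑ F(aᵢ) ξᵢ`, which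
preserves inner products. -/
theorem exists_partialIsometry (F : I → (H →L[ℂ] H))
    (hF : ∀ a c : I, star (F a) * F c = π (star (a : A) * c)) :
    ∃ V : H →L[ℂ] H, (∀ a : I, V * π a = F a) ∧ V * essProj π I = V ∧
      star V * V = essProj π I := by
  classical
  let e : (I →₀ H) →ₗ[ℂ] H := Finsupp.lsum ℂ fun a : I => (π (a : A) : H →ₗ[ℂ] H)
  let f : (I →₀ H) →ₗ[ℂ] H := Finsupp.lsum ℂ fun a : I => (F a : H →ₗ[ℂ] H)
  have he : ∀ x, e x = ∑ a ∈ x.support, π (a : A) (x a) := fun x => rfl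
  have hf : ∀ x, f x = ∑ a ∈ x.support, F a (x a) := fun x => rfl
  have hinner : ∀ x, ⟪f x, f x⟫_ℂ = ⟪e x, e x⟫_ℂ := by
    intro x
    rw [he, hf, sum_inner, sum_inner]
    refine Finset.sum_congr rfl fun a _ => ?_
    rw [inner_sum, inner_sum]
    refine Finset.sum_congr rfl fun c _ => ?_
    have h1 := congrArg (fun T : H →L[ℂ] H => ⟪x a, T (x c)⟫_ℂ) (hF a c)
    rw [_root_.map_mul, map_star] at h1
    simpa [star_eq_adjoint, adjoint_inner_right] using h1
  have hnorm : ∀ x, ‖f x‖ = ‖e x‖ := by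
    intro x
    rw [@norm_eq_sqrt_re_inner ℂ, @norm_eq_sqrt_re_inner ℂ, hinner]
  have hemem : ∀ x, e x ∈ essSubspace π I := fun x => by
    rw [he]
    exact sum_mem fun a _ => Submodule.le_topologicalClosure _
      (Submodule.subset_span ⟨a, a.2, x a, rfl⟩)
  let e' : (I →₀ H) →ₗ[ℂ] essSubspace π I := e.codRestrict _ hemem
  -- The isometry `e x ↦ f x` extends from the dense range of `e'` to `π(I) H`, by zero to `H`.
  have hdense : DenseRange e' := by
    have hspan : Submodule.span ℂ {η | ∃ a ∈ I, ∃ ξ, π a ξ = η} ≤ LinearMap.range e := by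
      rw [Submodule.span_le]
      rintro _ ⟨a, ha, ξ, rfl⟩
      exact ⟨Finsupp.single ⟨a, ha⟩ ξ, by simp [e]⟩
    rintro ⟨y, hy⟩
    rw [Topology.IsInducing.subtypeVal.closure_eq_preimage_closure_image]
    change y ∈ closure _
    refine closure_mono ?_ hy
    intro z hz
    obtain ⟨x, rfl⟩ := hspan hz
    exact ⟨e' x, ⟨x, rfl⟩, rfl⟩
  have hbd : ∀ x, ‖f x‖ ≤ 1 * ‖e' x‖ := fun x => by rw [one_mul, hnorm]; rfl
  let V₀ : essSubspace π I →L[ℂ] H := f.extendOfNorm e'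
  have hV₀ : ∀ x, V₀ (e' x) = f x := LinearMap.extendOfNorm_eq hdense ⟨1, hbd⟩
  let V : H →L[ℂ] H := V₀ ∘L (essSubspace π I).orthogonalProjectionOnto
  have hVe : V * essProj π I = V := by
    ext ξ
    change V₀ _ = V₀ _
    congr 1
    exact Submodule.orthogonalProjectionOnto_mem_subspace_eq_self _
  have hV : ∀ a : I, V * π a = F a := by
    intro a
    ext ξ
    have h1 := hV₀ (Finsupp.single a ξ)
    have h2 : (e' (Finsupp.single a ξ) : H) = π (a : A) ξ := by simp [e', e]
    have h3 : f (Finsupp.single a ξ) = F a ξ := by simp [f]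
    rw [h3] at h1
    rw [← h1]
    change V₀ _ = V₀ _
    congr 1
    rw [← Submodule.orthogonalProjectionOnto_mem_subspace_eq_self (e' (Finsupp.single a ξ)), h2]
    rfl
  refine ⟨V, hV, hVe, ?_⟩
  -- Both sides agree after multiplication by `π a` on the left and `π c` on the right, and `V*`
  -- takes values in `π(I) H`.
  have h1 : star V * V * essProj π I = 1 * essProj π I := by
    refine mul_essProj_ext π fun c hc => ?_
    have h2 : essProj π I * (star V * F ⟨c, hc⟩) = essProj π I * π c :=
      essProj_mul_ext π fun a ha => by
        have h3 := congrArg star (hV ⟨star a, star_mem ha⟩)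
        rw [star_mul, ← map_star, star_star] at h3
        have h4 := hF ⟨star a, star_mem ha⟩ ⟨c, hc⟩
        rw [← mul_assoc, h3, h4, star_star, _root_.map_mul]
    have h5 : essProj π I * star V = star V := by
      have h6 := congrArg star hVe
      rwa [star_mul, star_essProj] at h6
    rw [mul_assoc, hV ⟨c, hc⟩, one_mul]
    rwa [← mul_assoc, h5, essProj_mul_map π hc] at h2
  rwa [mul_assoc, hVe, one_mul] at h1

/-- Unitary multipliers of a closed ideal have images in `B(H)`. -/
theorem exists_isMultiplierImage {m : 𝓜(ℂ, I)} (hm : m ∈ unitary 𝓜(ℂ, I)) :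
    ∃ T, IsMultiplierImage π m T := by
  obtain ⟨T, h1, h2, -⟩ := exists_partialIsometry π (I := I) (fun a => π (lmul m a)) fun a c => by
    rw [← map_star, ← _root_.map_mul, star_lmul_mul_lmul hm a.2 c.2]
  exact ⟨T, fun a ha => h1 ⟨a, ha⟩, h2⟩

end EssentialSubspaces

/-! ### Convolution algebras and their representations -/

namespace TwistedSystem

variable {S A : Type*} [DivisionMonoid S] [NonUnitalCStarAlgebra A] {T : TwistedSystem S A}

theorem L1.ext_coeff {x y : T.L1} (h : ∀ s, (x.coeff s : A) = y.coeff s) : x = y :=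
  lp.ext (funext fun s => Subtype.ext (h s))

theorem coeff_single_self (s : S) (a : T.D s) : (T.single s a).coeff s = a := by
  classical
  exact lp.single_apply_self (E := fun s => T.D s) 1 s a

theorem coeff_single_ne {s t : S} (h : t ≠ s) (a : T.D s) : (T.single s a).coeff t = 0 := by
  classical
  exact lp.single_apply_ne (E := fun s => T.D s) 1 s a h

theorem single_congr {s t : S} (h : s = t) {a : T.D s} {c : T.D t} (hac : (a : A) = c) :
    T.single s a = T.single t c := by
  subst h
  rw [Subtype.ext hac]

theorem fstar_zero (s : S) : T.fstar s 0 = 0 :=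
  norm_le_zero_iff.1 ((T.norm_fstar_le (zero_mem _)).trans norm_zero.le)

theorem star_single (s : S) (a : T.D s) :
    star (T.single s a) = T.single s⁻¹ ⟨T.fstar s a, T.fstar_mem a.2⟩ := by
  refine L1.ext_coeff fun t => ?_
  rw [coeff_star]
  by_cases h : t = s⁻¹
  · subst h
    rw [coeff_single_self]
    change T.fstar s⁻¹⁻¹ ((T.single s a).coeff s⁻¹⁻¹) = T.fstar s a
    rw [inv_inv, coeff_single_self]
  · rw [coeff_single_ne h, coeff_single_ne (by rintro rfl; exact h (inv_inv t).symm)]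
    exact fstar_zero _

namespace StarRep

variable (R : StarRep T)

/-- The representation as a bounded linear map. -/
def toCLM : T.L1 →L[ℂ] (R.H →L[ℂ] R.H) :=
  LinearMap.mkContinuous
    { toFun := R.φ, map_add' := map_add R.φ, map_smul' := fun c x => map_smul R.φ c x } 1
    fun x => by rw [one_mul]; exact R.norm_le x

variable (K : Submodule ℂ R.H) [CompleteSpace K]

theorem apply_mul_starProjection (hK : ∀ x, K.starProjection * R.φ x = R.φ x) (x : T.L1) :
    R.φ x * K.starProjection = R.φ x := by
  have h := congrArg star (hK (star x))
  rwa [star_mul, map_star, star_star, (isSelfAdjoint_starProjection K).star_eq] at h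

/-- The restriction of a representation to a closed subspace `K` that contains the ranges of all
its operators. -/
def restrict (hK : ∀ x, K.starProjection * R.φ x = R.φ x) : StarRep T where
  H := K
  φ :=
    { toFun := fun x => K.orthogonalProjectionOnto ∘L R.φ x ∘L K.subtypeL
      map_smul' := fun c x => by
        rw [map_smul]; ext; simp
      map_zero' := by
        rw [map_zero]; ext; simp
      map_add' := fun x y => by
        rw [map_add]; ext; simp
      map_mul' := fun x y => by
        rw [map_mul]
        conv_lhs => rw [← hK y]
        rfl
      map_star' := fun x => by
        simp only [map_star, star_eq_adjoint, adjoint_comp, Submodule.adjoint_subtypeL,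
          Submodule.adjoint_orthogonalProjectionOnto]
        rfl }
  norm_le := fun x => by
    change ‖K.orthogonalProjectionOnto ∘L R.φ x ∘L K.subtypeL‖ ≤ _
    have h1 : ‖K.orthogonalProjectionOnto‖ ≤ 1 := K.orthogonalProjectionOnto_norm_le
    have h2 : ‖K.subtypeL‖ ≤ 1 := K.norm_subtypeL_le
    calc _ ≤ ‖K.orthogonalProjectionOnto‖ * (‖R.φ x‖ * ‖K.subtypeL‖) :=
          (opNorm_comp_le _ _).trans (by gcongr; exact opNorm_comp_le _ _)
      _ ≤ 1 * (‖x‖ * 1) := by gcongr; exact R.norm_le x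
      _ = ‖x‖ := by ring

theorem restrict_apply (hK : ∀ x, K.starProjection * R.φ x = R.φ x) (x : T.L1) :
    (R.restrict K hK).φ x = K.orthogonalProjectionOnto ∘L R.φ x ∘L K.subtypeL := rfl

theorem norm_restrict (hK : ∀ x, K.starProjection * R.φ x = R.φ x) (x : T.L1) :
    ‖R.φ x‖ ≤ ‖(R.restrict K hK).φ x‖ := by
  have h : R.φ x = K.subtypeL ∘L
      ((K.orthogonalProjectionOnto ∘L R.φ x ∘L K.subtypeL) ∘L K.orthogonalProjectionOnto) := by
    conv_lhs => rw [← R.apply_mul_starProjection K hK x, ← hK x]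
    rfl
  have h1 : ‖K.orthogonalProjectionOnto‖ ≤ 1 := K.orthogonalProjectionOnto_norm_le
  have h2 : ‖K.subtypeL‖ ≤ 1 := K.norm_subtypeL_le
  rw [restrict_apply]
  set Y := K.orthogonalProjectionOnto ∘L R.φ x ∘L K.subtypeL
  calc ‖R.φ x‖ = _ := congrArg norm h
    _ ≤ ‖K.subtypeL‖ * (‖Y‖ * ‖K.orthogonalProjectionOnto‖) :=
          (opNorm_comp_le _ _).trans (by gcongr; exact opNorm_comp_le _ _)
    _ ≤ 1 * (‖Y‖ * 1) := by gcongr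
    _ = ‖Y‖ := by ring

end StarRep

end TwistedSystem

/-! ### Algebra of Busby–Smith twisted actions -/

namespace BusbySmithAction

open TwistedSystem

variable {S A : Type*} [InverseMonoid S] [NonUnitalCStarAlgebra A]

theorem inv_eq_of_isIdempotentElem {e : S} (he : IsIdempotentElem e) : e⁻¹ = e :=
  (InverseMonoid.eq_inv_of_mul e e (by rw [he.eq, he.eq]) (by rw [he.eq, he.eq])).symm

theorem isIdempotentElem_inv_mul (s : S) : IsIdempotentElem (s⁻¹ * s) := by
  rw [IsIdempotentElem, mul_assoc, ← mul_assoc s, InverseMonoid.mul_inv_mul_self]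

theorem isIdempotentElem_mul_inv (s : S) : IsIdempotentElem (s * s⁻¹) := by
  rw [IsIdempotentElem, ← mul_assoc, InverseMonoid.mul_inv_mul_self]

variable (b : BusbySmithAction S A)

theorem mem_D_one (a : A) : a ∈ b.D 1 := by
  rw [b.D_one]; trivial

theorem D_mul_inv_le (s t : S) : b.D (s * t)⁻¹ ≤ b.D t⁻¹ :=
  fun a ha => ((b.comp_domain s t a).2 ha).1

theorem D_mul_le (s t : S) : b.D (s * t) ≤ b.D s := by
  have h := b.D_mul_inv_le t⁻¹ s⁻¹
  rwa [mul_inv_rev, inv_inv, inv_inv] at h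

theorem D_mul_inv_self (s : S) : b.D (s * s⁻¹) = b.D s := by
  have h := b.D_inv_mul s⁻¹
  rwa [inv_inv] at h

/-- `β_e` is the identity of `A_e` for idempotents `e`, since `β_e β_e = β_e` and `β_e` is
injective. -/
theorem pmap_β_idempotent {e : S} (he : IsIdempotentElem e) {a : A} (ha : a ∈ b.D e) :
    pmap (b.β e) a = a := by
  have hi := inv_eq_of_isIdempotentElem he
  have ha' : a ∈ b.D e⁻¹ := by rwa [hi]
  have hb : pmap (b.β e) a ∈ b.D e := pmap_mem _ ha'
  have hb' : pmap (b.β e) a ∈ b.D e⁻¹ := (congrArg b.D hi).ge hb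
  have h : pmap (b.β e) (pmap (b.β e) a) = pmap (b.β e) a := by
    have ha'' : a ∈ b.D (e * e)⁻¹ := by rwa [he.eq]
    have hc : pmap (b.β (e * e)) a ∈ b.D (e * e) := pmap_mem _ ha''
    rw [b.comp e e a ha'', b.w_idempotent e e (Or.inl he), adMul, star_one, lmul_one hc,
      rmul_one hc, he.eq]
  have h2 := congrArg (pmap (b.β e).symm) h
  rwa [pmap_symm_pmap _ hb', pmap_symm_pmap _ ha'] at h2

theorem pmap_β_inv_pmap_β {s : S} {a : A} (ha : a ∈ b.D s⁻¹) :
    pmap (b.β s⁻¹) (pmap (b.β s) a) = adMul (b.w s⁻¹ s) a := by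
  have he := isIdempotentElem_inv_mul s
  have ha' : a ∈ b.D (s⁻¹ * s) := (b.D_inv_mul s).ge ha
  rw [b.comp _ _ _ (by rwa [inv_eq_of_isIdempotentElem he]), b.pmap_β_idempotent he ha']

/-- On `A_t ∩ A_{s*}` the coefficient of `(c δ_s) (d δ_t)` is `c β_s(d) w_{s,t}`. -/
theorem fmul_of_mem {s t : S} {c d : A} (hc : c ∈ b.D s) (hd : d ∈ b.D s⁻¹) :
    b.toTwistedSystem.fmul s t c d = rmul (b.w s t) (c * pmap (b.β s) d) := by
  change rmul (b.w s t) (pmap (b.β s) (pmap (b.β s).symm c * d)) = _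
  rw [pmap_mul _ (pmap_mem _ hc) hd, pmap_pmap_symm _ hc]

/-- The element `a δ_s` of the convolution algebra. -/
def delta (s : S) (a : A) (ha : a ∈ b.D s) : b.toTwistedSystem.L1 :=
  b.toTwistedSystem.single s ⟨a, ha⟩

theorem fmul_mem_D {s t : S} {a c : A} (ha : a ∈ b.D s) (hc : c ∈ b.D t) :
    b.toTwistedSystem.fmul s t a c ∈ b.D (s * t) :=
  b.toTwistedSystem.fmul_mem ha hc

theorem fstar_mem_D {s : S} {a : A} (ha : a ∈ b.D s) : b.toTwistedSystem.fstar s a ∈ b.D s⁻¹ :=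
  b.toTwistedSystem.fstar_mem ha

variable {b} in
theorem delta_congr {s t : S} (h : s = t) {a c : A} (hac : a = c) (ha : a ∈ b.D s)
    (hc : c ∈ b.D t) : b.delta s a ha = b.delta t c hc :=
  single_congr h hac

theorem delta_mul_delta {s t : S} {a c : A} (ha : a ∈ b.D s) (hc : c ∈ b.D t) :
    b.delta s a ha * b.delta t c hc =
      b.delta (s * t) (b.toTwistedSystem.fmul s t a c) (b.fmul_mem_D ha hc) :=
  single_mul_single _ _ _ _ _

theorem star_delta {s : S} {a : A} (ha : a ∈ b.D s) :
    star (b.delta s a ha) =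
      b.delta s⁻¹ (b.toTwistedSystem.fstar s a) (b.fstar_mem_D ha) :=
  star_single _ _

theorem delta_one_mul_delta {p : S} (c : A) {d : A} (hd : d ∈ b.D p) :
    b.delta 1 c (b.mem_D_one c) * b.delta p d hd =
      b.delta p (c * d) ((b.isClosedIdeal p).mul_mem_left c hd) := by
  rw [delta_mul_delta]
  refine delta_congr (one_mul p) ?_ _ _
  have hd' : d ∈ b.D 1⁻¹ := by rw [inv_one]; exact b.mem_D_one _
  have hcd : c * d ∈ b.D (1 * p) := by
    rw [one_mul]; exact (b.isClosedIdeal p).mul_mem_left c hd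
  rw [b.fmul_of_mem (b.mem_D_one c) hd',
    b.pmap_β_idempotent IsIdempotentElem.one (b.mem_D_one _),
    b.w_idempotent _ _ (Or.inl IsIdempotentElem.one), rmul_one hcd]

theorem delta_mul_delta_one {p : S} {c d : A} (hc : c ∈ b.D p) (hd : d ∈ b.D p⁻¹) :
    b.delta p c hc * b.delta 1 d (b.mem_D_one d) =
      b.delta p (c * pmap (b.β p) d) ((b.isClosedIdeal p).mul_mem_right _ hc) := by
  rw [delta_mul_delta]
  refine delta_congr (mul_one p) ?_ _ _
  have hcd : c * pmap (b.β p) d ∈ b.D (p * 1) := by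
    rw [mul_one]; exact (b.isClosedIdeal p).mul_mem_right _ hc
  rw [b.fmul_of_mem hc hd, b.w_idempotent _ _ (Or.inr IsIdempotentElem.one), rmul_one hcd]

theorem star_delta_one (c : A) :
    star (b.delta 1 c (b.mem_D_one c)) = b.delta 1 (star c) (b.mem_D_one _) := by
  rw [star_delta]
  refine delta_congr inv_one ?_ _ _
  change rmul (star (b.w 1⁻¹ 1)) (pmap (b.β 1).symm (star c)) = star c
  have h1 : star c ∈ b.D 1⁻¹ := by rw [inv_one]; exact b.mem_D_one _
  have h2 : pmap (b.β 1).symm (star c) = star c := by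
    have h := congrArg (pmap (b.β 1).symm)
      (b.pmap_β_idempotent IsIdempotentElem.one (b.mem_D_one (star c)))
    rwa [pmap_symm_pmap _ h1, eq_comm] at h
  rw [h2, b.w_idempotent _ _ (Or.inr IsIdempotentElem.one), star_one, rmul_one]
  rw [mul_one]; exact h1

/-- `(β_p(a) δ_p)* (β_p(c) δ_p) = a* c δ_{p*p}`. -/
theorem star_delta_mul_delta {p : S} {a c : A} (ha : a ∈ b.D p⁻¹) (hc : c ∈ b.D p⁻¹) :
    star (b.delta p (pmap (b.β p) a) (pmap_mem _ ha)) *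
        b.delta p (pmap (b.β p) c) (pmap_mem _ hc) =
      b.delta (p⁻¹ * p) (star a * c)
        ((b.isClosedIdeal _).mul_mem_left _ ((b.D_inv_mul p).ge hc)) := by
  rw [star_delta, delta_mul_delta]
  refine delta_congr rfl ?_ _ _
  have ha' : a ∈ b.D (p⁻¹ * p) := (b.D_inv_mul p).ge ha
  have hc' : c ∈ b.D (p⁻¹ * p) := (b.D_inv_mul p).ge hc
  have hβc : pmap (b.β p) c ∈ b.D p⁻¹⁻¹ := (congrArg b.D (inv_inv p)).ge (pmap_mem _ hc)
  have hI := b.isClosedIdeal (p⁻¹ * p)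
  have hu := b.w_unitary p⁻¹ p
  have hfs : b.toTwistedSystem.fstar p (pmap (b.β p) a) =
      rmul (star (b.w p⁻¹ p)) (star a) := by
    change rmul (star (b.w p⁻¹ p)) (pmap (b.β p).symm (star (pmap (b.β p) a))) = _
    rw [← star_pmap _ ha, pmap_symm_pmap _ (star_mem ha)]
  have hmem : rmul (star (b.w p⁻¹ p)) (star a) ∈ b.D p⁻¹ :=
    (b.D_inv_mul p).le (rmul_mem _ (star_mem ha'))
  rw [hfs, b.fmul_of_mem hmem hβc, b.pmap_β_inv_pmap_β hc, adMul,
    rmul_mul_left hI _ _ (rmul_mem _ (lmul_mem _ hc')), rmul_rmul_star hu (lmul_mem _ hc'),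
    ← rmul_mul _ (rmul_mem _ (star_mem ha')) hc', rmul_rmul_star hu (star_mem ha')]

/-- `(c δ_p) (d δ_p)* = c d* δ_{pp*}`. The cocycle identity for `p, p*, p` says that `β_p` carries
`w_{p*,p}` to `w_{p,p*}`, which makes the twists cancel. -/
theorem delta_mul_star_delta {p : S} {c d : A} (hc : c ∈ b.D p) (hd : d ∈ b.D p) :
    b.delta p c hc * star (b.delta p d hd) =
      b.delta (p * p⁻¹) (c * star d)
        ((b.isClosedIdeal _).mul_mem_right _ ((b.D_mul_inv_self p).ge hc)) := by
  rw [star_delta, delta_mul_delta]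
  refine delta_congr rfl ?_ _ _
  have hu := b.w_unitary p⁻¹ p
  set k := pmap (b.β p).symm c with hk
  set k' := pmap (b.β p).symm (star d) with hk'
  have hkm : k ∈ b.D p⁻¹ := pmap_mem _ hc
  have hk'm : k' ∈ b.D p⁻¹ := pmap_mem _ (star_mem hd)
  have hk'J : k' ∈ b.D (p⁻¹ * p) := (b.D_inv_mul p).ge hk'm
  have hkk : k * k' ∈ b.D (p⁻¹ * p) := (b.isClosedIdeal _).mul_mem_left _ hk'J
  change rmul (b.w p p⁻¹) (pmap (b.β p) (k * rmul (star (b.w p⁻¹ p)) k')) = _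
  rw [← rmul_mul_left (b.isClosedIdeal _) _ _ hk'J]
  set y := rmul (star (b.w p⁻¹ p)) (k * k') with hy
  have hyJ : y ∈ b.D (p⁻¹ * p) := rmul_mem _ hkk
  have hyp : y ∈ b.D p⁻¹ := (b.D_inv_mul p).le hyJ
  have hcc := b.cocycle p p⁻¹ p y ⟨hyp, hyJ⟩
  have hkp : k * k' ∈ b.D p⁻¹ := (b.D_inv_mul p).le hkk
  have h1 : pmap (b.β p) (k * k') ∈ b.D (p * (p⁻¹ * p)) := by
    refine (congrArg b.D ?_).ge (pmap_mem _ hkp)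
    rw [← mul_assoc, InverseMonoid.mul_inv_mul_self]
  have h2 : rmul (b.w p p⁻¹) (pmap (b.β p) y) ∈ b.D (p * p⁻¹ * p) :=
    (congrArg b.D (InverseMonoid.mul_inv_mul_self p)).ge
      ((b.D_mul_inv_self p).le (rmul_mem _ ((b.D_mul_inv_self p).ge (pmap_mem _ hyp))))
  rw [b.w_idempotent p _ (Or.inr (isIdempotentElem_inv_mul p)),
    b.w_idempotent _ p (Or.inl (isIdempotentElem_mul_inv p)), rmul_rmul_star hu hkk,
    rmul_one h1, rmul_one h2, pmap_mul _ hkm hk'm, pmap_pmap_symm _ hc,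
    pmap_pmap_symm _ (star_mem hd)] at hcc
  exact hcc.symm

end BusbySmithAction

/-! ### From representations of the convolution algebra to covariant representations -/

namespace BusbySmithAction

open TwistedSystem

theorem CovariantRep.integratedForm_apply {S A : Type*} [InverseMonoid S]
    [NonUnitalCStarAlgebra A] {b : BusbySmithAction S A} (ρ : CovariantRep b)
    (x : b.toTwistedSystem.L1) :
    (ρ.integratedForm.φ x : ρ.H →L[ℂ] ρ.H) = ∑' s, ρ.π (x.coeff s) * ρ.V s :=
  rfl

theorem CovariantRep.integratedForm_delta {S A : Type*} [InverseMonoid S]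
    [NonUnitalCStarAlgebra A] {b : BusbySmithAction S A} (ρ : CovariantRep b) {s : S} {a : A}
    (ha : a ∈ b.D s) :
    (ρ.integratedForm.φ (b.delta s a ha) : ρ.H →L[ℂ] ρ.H) = ρ.π a * ρ.V s := by
  rw [ρ.integratedForm_apply, tsum_eq_single s]
  · rw [delta, coeff_single_self]
  · intro t ht
    rw [delta, coeff_single_ne ht]
    exact (congrArg (· * ρ.V t) (map_zero ρ.π)).trans (zero_mul _)

section Disintegration

universe w y z

variable {S : Type y} {A : Type z} [InverseMonoid S] [NonUnitalCStarAlgebra A]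
  {b : BusbySmithAction S A} (φ : StarRep.{w} b.toTwistedSystem)

/-- The representation `a ↦ φ(a δ_1)` of the coefficient algebra. -/
def coeffRep : A →⋆ₙₐ[ℂ] (φ.H →L[ℂ] φ.H) where
  toFun a := φ.φ (b.delta 1 a (b.mem_D_one a))
  map_smul' c a := by
    rw [MonoidHom.id_apply, ← map_smul]
    exact congrArg φ.φ ((b.toTwistedSystem.single 1).map_smul c ⟨a, b.mem_D_one a⟩)
  map_zero' := by
    rw [← map_zero φ.φ]
    exact congrArg φ.φ (b.toTwistedSystem.single 1).map_zero
  map_add' a c := by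
    rw [← map_add]
    exact congrArg φ.φ ((b.toTwistedSystem.single 1).map_add ⟨a, b.mem_D_one a⟩ ⟨c, b.mem_D_one c⟩)
  map_mul' a c := by
    rw [← map_mul, delta_one_mul_delta]
  map_star' a := by
    rw [← map_star, star_delta_one]

theorem coeffRep_apply (a : A) : coeffRep φ a = φ.φ (b.delta 1 a (b.mem_D_one a)) := rfl

/-- `φ` identifies `a δ_e` with `a δ_1` for all idempotents `e`, as integrated forms of covariant
representations do. -/
def IdentifiesIdempotents : Prop :=
  ∀ e, IsIdempotentElem e → ∀ (a : A) (ha : a ∈ b.D e), φ.φ (b.delta e a ha) = coeffRep φ a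

theorem coeffRep_mul_map_delta {p : S} (c : A) {d : A} (hd : d ∈ b.D p) :
    coeffRep φ c * φ.φ (b.delta p d hd) =
      φ.φ (b.delta p (c * d) ((b.isClosedIdeal p).mul_mem_left c hd)) := by
  rw [coeffRep_apply, ← map_mul, delta_one_mul_delta]

theorem map_delta_mul_coeffRep {p : S} {c d : A} (hc : c ∈ b.D p) (hd : d ∈ b.D p⁻¹) :
    φ.φ (b.delta p c hc) * coeffRep φ d =
      φ.φ (b.delta p (c * pmap (b.β p) d) ((b.isClosedIdeal p).mul_mem_right _ hc)) := by
  rw [coeffRep_apply, ← map_mul, delta_mul_delta_one _ _ hd]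

variable {φ} (hφ : IdentifiesIdempotents φ)
include hφ

theorem IdentifiesIdempotents.star_map_mul_map {p : S} {a c : A} (ha : a ∈ b.D p⁻¹)
    (hc : c ∈ b.D p⁻¹) :
    star (φ.φ (b.delta p (pmap (b.β p) a) (pmap_mem _ ha))) *
      φ.φ (b.delta p (pmap (b.β p) c) (pmap_mem _ hc)) = coeffRep φ (star a * c) := by
  rw [← map_star, ← map_mul, b.star_delta_mul_delta ha hc, hφ _ (isIdempotentElem_inv_mul p)]

theorem IdentifiesIdempotents.map_mul_star_map {p : S} {c d : A} (hc : c ∈ b.D p) (hd : d ∈ b.D p) :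
    φ.φ (b.delta p c hc) * star (φ.φ (b.delta p d hd)) = coeffRep φ (c * star d) := by
  rw [← map_star, ← map_mul, delta_mul_star_delta, hφ _ (isIdempotentElem_mul_inv p)]

theorem IdentifiesIdempotents.essProj_mul {p : S} {c : A} (hc : c ∈ b.D p) :
    essProj (coeffRep φ) (b.D p) * φ.φ (b.delta p c hc) = φ.φ (b.delta p c hc) := by
  refine mul_eq_self_of_mul_star ?_
  rw [hφ.map_mul_star_map, essProj_mul_map _ ((b.isClosedIdeal p).mul_mem_right _ hc)]

theorem IdentifiesIdempotents.mul_essProj {p : S} {c : A} (hc : c ∈ b.D p) :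
    φ.φ (b.delta p c hc) * essProj (coeffRep φ) (b.D p⁻¹) = φ.φ (b.delta p c hc) := by
  have hk : pmap (b.β p).symm c ∈ b.D p⁻¹ := pmap_mem _ hc
  rw [delta_congr rfl (pmap_pmap_symm (b.β p) hc).symm hc (pmap_mem _ hk)]
  refine mul_eq_self_of_star_mul (star_essProj _ _) ?_
  rw [hφ.star_map_mul_map hk hk, map_mul_essProj _ ((b.isClosedIdeal _).mul_mem_left _ hk)]

omit hφ in
variable (φ) in
/-- `V` is the partial isometry with initial space `π(A_{p*}) H` and `V π(a) = φ(β_p(a) δ_p)`, where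
`π(a) = φ(a δ_1)`. -/
structure Implements (p : S) (V : φ.H →L[ℂ] φ.H) : Prop where
  mul_coeffRep : ∀ (a : A) (ha : a ∈ b.D p⁻¹),
    V * coeffRep φ a = φ.φ (b.delta p (pmap (b.β p) a) (pmap_mem _ ha))
  mul_essProj : V * essProj (coeffRep φ) (b.D p⁻¹) = V
  initial : star V * V = essProj (coeffRep φ) (b.D p⁻¹)

theorem IdentifiesIdempotents.exists_implements (p : S) : ∃ V, Implements φ p V := by
  obtain ⟨V, h1, h2, h3⟩ := exists_partialIsometry (coeffRep φ) (I := b.D p⁻¹)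
    (fun a => φ.φ (b.delta p (pmap (b.β p) a) (pmap_mem _ a.2)))
    fun a c => hφ.star_map_mul_map a.2 c.2
  exact ⟨V, fun a ha => h1 ⟨a, ha⟩, h2, h3⟩

theorem Implements.coeffRep_mul {p : S} {V : φ.H →L[ℂ] φ.H} (hV : Implements φ p V) {c : A}
    (hc : c ∈ b.D p) : coeffRep φ c * V = φ.φ (b.delta p c hc) := by
  rw [← hφ.mul_essProj hc, ← hV.mul_essProj, ← mul_assoc]
  refine mul_essProj_ext _ fun a ha => ?_
  rw [mul_assoc, hV.mul_coeffRep a ha, coeffRep_mul_map_delta, map_delta_mul_coeffRep φ hc ha]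

theorem Implements.mul_coeffRep_comm {p : S} {V : φ.H →L[ℂ] φ.H} (hV : Implements φ p V) {a : A}
    (ha : a ∈ b.D p⁻¹) : V * coeffRep φ a = coeffRep φ (pmap (b.β p) a) * V := by
  rw [hV.mul_coeffRep a ha, hV.coeffRep_mul hφ]

theorem Implements.essProj_mul {p : S} {V : φ.H →L[ℂ] φ.H} (hV : Implements φ p V) :
    essProj (coeffRep φ) (b.D p) * V = V := by
  rw [← hV.mul_essProj, ← mul_assoc]
  refine mul_essProj_ext _ fun a ha => ?_
  rw [mul_assoc, hV.mul_coeffRep a ha, hφ.essProj_mul]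

theorem Implements.final {p : S} {V : φ.H →L[ℂ] φ.H} (hV : Implements φ p V) :
    V * star V = essProj (coeffRep φ) (b.D p) := by
  -- The projection `Q = V V*` fixes `π(c) H`, because `π(c)* Q π(c) = π(c)* π(c)`.
  have hfix : ∀ c ∈ b.D p, V * star V * coeffRep φ c = coeffRep φ c := by
    intro c hc
    set X := coeffRep φ c with hX
    have h1 : star X * (V * star V) * X = star X * X := by
      have h2 := hφ.map_mul_star_map (star_mem hc) (star_mem hc)
      rw [← hV.coeffRep_mul hφ (star_mem hc), star_mul, ← map_star, star_star,
        map_mul, map_star] at h2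
      simpa only [mul_assoc] using h2
    have hQ : V * star V * (V * star V) = V * star V := by
      calc V * star V * (V * star V) = V * (star V * V) * star V := by simp only [mul_assoc]
        _ = V * star V := by rw [hV.initial, hV.mul_essProj]
    have h0 : star (V * star V * X - X) * (V * star V * X - X) = 0 := by
      calc star (V * star V * X - X) * (V * star V * X - X)
          = star X * (V * star V * (V * star V)) * X - star X * (V * star V) * X -
              star X * (V * star V) * X + star X * X := by
            simp only [star_sub, star_mul, star_star]
            noncomm_ring
        _ = 0 := by rw [hQ, h1]; abel
    exact sub_eq_zero.1 ((CStarRing.star_mul_self_eq_zero_iff _).1 h0)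
  have h1 : V * star V * essProj (coeffRep φ) (b.D p) = 1 * essProj (coeffRep φ) (b.D p) :=
    mul_essProj_ext _ fun c hc => by rw [hfix c hc, one_mul]
  have h2 := congrArg star (hV.essProj_mul hφ)
  rw [star_mul, star_essProj] at h2
  rwa [mul_assoc, h2, one_mul] at h1

theorem Implements.covariant {p : S} {V : φ.H →L[ℂ] φ.H} (hV : Implements φ p V) {a : A}
    (ha : a ∈ b.D p⁻¹) : coeffRep φ (pmap (b.β p) a) = V * coeffRep φ a * star V := by
  rw [hV.mul_coeffRep_comm hφ ha, mul_assoc, hV.final hφ, map_mul_essProj _ (pmap_mem _ ha)]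

/-- `V_p V_q` has its initial space inside `π(A_{(pq)*}) H`: the operators `π(d) V_p V_q π(a)` with
`d ∈ A_p` and `a ∈ A_{q*}` are in the image of the fibre at `pq`, and they determine `V_p V_q`. -/
theorem Implements.mul_mul_essProj {p q : S} {V W : φ.H →L[ℂ] φ.H} (hV : Implements φ p V)
    (hW : Implements φ q W) :
    V * W * essProj (coeffRep φ) (b.D (p * q)⁻¹) = V * W := by
  set E := essProj (coeffRep φ) (b.D (p * q)⁻¹) with hE
  have hle := b.D_mul_inv_le p q
  have h1 : essProj (coeffRep φ) (b.D p) * (V * W * E * essProj (coeffRep φ) (b.D q⁻¹)) =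
      essProj (coeffRep φ) (b.D p) * (V * W * essProj (coeffRep φ) (b.D q⁻¹)) := by
    refine essProj_mul_ext (coeffRep φ) fun d hd => ?_
    rw [← mul_assoc (coeffRep φ d) (V * W * E),
      ← mul_assoc (coeffRep φ d) (V * W) (essProj (coeffRep φ) (b.D q⁻¹))]
    refine mul_essProj_ext (coeffRep φ) fun a ha => ?_
    have h2 : coeffRep φ d * (V * W) * coeffRep φ a =
        φ.φ (b.delta p d hd) * φ.φ (b.delta q _ (pmap_mem (b.β q) ha)) := by
      rw [← hV.coeffRep_mul hφ hd, ← hW.mul_coeffRep a ha]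
      simp only [mul_assoc]
    rw [← map_mul, delta_mul_delta] at h2
    calc coeffRep φ d * (V * W * E) * coeffRep φ a
        = coeffRep φ d * (V * W) * (E * coeffRep φ a) := by simp only [mul_assoc]
      _ = coeffRep φ d * (V * W) * coeffRep φ a * E := by
          rw [hE, essProj_mul_map_comm (coeffRep φ) (b.isClosedIdeal _)]; simp only [mul_assoc]
      _ = coeffRep φ d * (V * W) * coeffRep φ a := by
          rw [h2, hE, hφ.mul_essProj]
  have hl : V * W * E * essProj (coeffRep φ) (b.D q⁻¹) = V * W * E := by
    rw [mul_assoc, hE, essProj_mul_essProj_of_le' _ hle]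
  have hr : V * W * essProj (coeffRep φ) (b.D q⁻¹) = V * W := by
    rw [mul_assoc, hW.mul_essProj]
  have hp : ∀ Z, essProj (coeffRep φ) (b.D p) * (V * Z) = V * Z := fun Z => by
    rw [← mul_assoc, hV.essProj_mul hφ]
  rwa [hl, hr, mul_assoc V W E, hp, hp, ← mul_assoc] at h1

/-- `V_p φ(c δ_q) = φ(β_p(c) w_{p,q} δ_{pq})` for `c ∈ A_q ∩ A_{p*}`. Both sides have range in
`π(A_p) H`, so it is enough to compare them after multiplication by `π(d)`, `d ∈ A_p`. -/
theorem Implements.mul_map_delta {p q : S} {V : φ.H →L[ℂ] φ.H} (hV : Implements φ p V) {c : A}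
    (hc : c ∈ b.D q) (hc' : c ∈ b.D p⁻¹) :
    V * φ.φ (b.delta q c hc) =
      φ.φ (b.delta (p * q) (rmul (b.w p q) (pmap (b.β p) c))
        (rmul_mem _ (b.map_mem p q c hc' hc))) := by
  have hpq := b.map_mem p q c hc' hc
  have h1 : essProj (coeffRep φ) (b.D p) * (V * φ.φ (b.delta q c hc)) =
      essProj (coeffRep φ) (b.D p) * φ.φ (b.delta (p * q) _ (rmul_mem (b.w p q) hpq)) := by
    refine essProj_mul_ext (coeffRep φ) fun d hd => ?_
    rw [← mul_assoc, hV.coeffRep_mul hφ hd, ← map_mul, delta_mul_delta, coeffRep_mul_map_delta]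
    refine congrArg φ.φ (delta_congr rfl ?_ _ _)
    rw [b.fmul_of_mem hd hc', rmul_mul_left (b.isClosedIdeal _) _ _ hpq]
  rw [← mul_assoc, hV.essProj_mul hφ] at h1
  rw [h1, ← hφ.essProj_mul (rmul_mem (b.w p q) hpq), ← mul_assoc,
    essProj_mul_essProj_of_le _ (b.D_mul_le p q)]

/-- `V_p V_q = π(w_{p,q}) V_{pq}`. -/
theorem Implements.mul {p q : S} {V W X T : φ.H →L[ℂ] φ.H} (hV : Implements φ p V)
    (hW : Implements φ q W) (hX : Implements φ (p * q) X)
    (hT : IsMultiplierImage (coeffRep φ) (b.w p q) T) : V * W = T * X := by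
  rw [← hV.mul_mul_essProj hφ hW, ← hX.mul_essProj, ← mul_assoc T]
  refine mul_essProj_ext _ fun a ha => ?_
  obtain ⟨ha1, ha2⟩ := (b.comp_domain p q a).2 ha
  have hβ : pmap (b.β (p * q)) a ∈ b.D (p * q) := pmap_mem _ ha
  rw [mul_assoc, hW.mul_coeffRep a ha1, hV.mul_map_delta hφ (pmap_mem _ ha1) ha2,
    mul_assoc, hX.mul_coeffRep_comm hφ ha, ← mul_assoc, hT.mul_map _ hβ,
    hX.coeffRep_mul hφ (lmul_mem _ hβ)]
  refine congrArg φ.φ (delta_congr rfl ?_ _ _)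
  rw [b.comp p q a ha, adMul, rmul_rmul_star (b.w_unitary p q) (lmul_mem _ hβ)]

/-- Every representation of the convolution algebra that is nondegenerate on the coefficients and
identifies idempotents is the integrated form of a covariant representation. -/
theorem IdentifiesIdempotents.exists_covariantRep (hnd : essSubspace (coeffRep φ) ⊤ = ⊤) :
    ∃ ρ : CovariantRep.{w} b, ∀ x, ‖φ.φ x‖ = ‖ρ.integratedForm.φ x‖ := by
  choose V hV using hφ.exists_implements
  let ρ : CovariantRep.{w} b :=
    { H := φ.H
      π := coeffRep φ
      nondegenerate := hnd
      V := V
      initial := fun s => (hV s).initial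
      final := fun s => (hV s).final hφ
      mul := fun r s => by
        obtain ⟨T, hT⟩ := exists_isMultiplierImage (coeffRep φ) (b.w_unitary r s)
        exact ⟨T, hT, (hV r).mul hφ (hV s) (hV (r * s)) hT⟩
      covariant := fun s a ha => (hV s).covariant hφ ha }
  refine ⟨ρ, fun x => ?_⟩
  let ψ : b.toTwistedSystem.L1 →L[ℂ] (φ.H →L[ℂ] φ.H) := ρ.integratedForm.toCLM
  have h : φ.toCLM = ψ := by
    refine L1.hom_ext fun s a => ?_
    have h1 : ψ (b.toTwistedSystem.single s a) = coeffRep φ a * V s := ρ.integratedForm_delta a.2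
    rw [h1, (hV s).coeffRep_mul hφ a.2]
    rfl
  exact congrArg (fun f : b.toTwistedSystem.L1 →L[ℂ] (φ.H →L[ℂ] φ.H) => ‖f x‖) h

omit hφ in
variable (φ) in
/-- Restricting `φ` to the essential subspace of its coefficients makes these nondegenerate. -/
theorem essSubspace_coeffRep_restrict
    (hK : ∀ x, (essSubspace (coeffRep φ) ⊤).starProjection * φ.φ x = φ.φ x) :
    essSubspace (coeffRep (φ.restrict (essSubspace (coeffRep φ) ⊤) hK)) ⊤ = ⊤ := by
  set K := essSubspace (coeffRep φ) ⊤ with hKdef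
  let π' : A →⋆ₙₐ[ℂ] (K →L[ℂ] K) := coeffRep (φ.restrict K hK)
  change essSubspace π' ⊤ = ⊤
  -- With the projection `Q` onto the essential subspace inside `K`, the operator `j (1 - Q) r`
  -- annihilates `π(A) H`, hence `K`.
  let j : K →L[ℂ] φ.H := K.subtypeL
  let r : φ.H →L[ℂ] K := K.orthogonalProjectionOnto
  let Q : K →L[ℂ] K := essProj π' ⊤
  have hrj : ∀ ξ : K, r (j ξ) = ξ := fun ξ =>
    Submodule.orthogonalProjectionOnto_mem_subspace_eq_self ξ
  have h1 : (j ∘L (1 - Q) ∘L r) * essProj (coeffRep φ) ⊤ = 0 * essProj (coeffRep φ) ⊤ := by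
    refine mul_essProj_ext _ fun a _ => ?_
    have h2 : (1 - Q) * π' a = 0 := by
      have ha : a ∈ (⊤ : NonUnitalStarSubalgebra ℂ A) := trivial
      rw [sub_mul, one_mul, essProj_mul_map π' ha, sub_self]
    have h3 : coeffRep φ a = coeffRep φ a * K.starProjection :=
      (φ.apply_mul_starProjection K hK _).symm
    rw [h3, zero_mul]
    ext ξ
    have h4 := congrArg (fun f : K →L[ℂ] K => (f (r ξ) : φ.H)) h2
    exact h4
  have h5 : ∀ ξ : K, Q ξ = ξ := by
    intro ξ
    have h6 := congrArg (fun f : φ.H →L[ℂ] φ.H => f (j ξ)) h1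
    have h7 : essProj (coeffRep φ) ⊤ (j ξ) = j ξ :=
      Submodule.starProjection_eq_self_iff.2 ξ.2
    have h8 : j ((1 - Q) (r (essProj (coeffRep φ) ⊤ (j ξ)))) = 0 := by simpa using! h6
    rw [h7, hrj] at h8
    have h9 : (1 - Q) ξ = 0 := Subtype.ext h8
    exact (sub_eq_zero.1 h9).symm
  refine Submodule.eq_top_iff'.2 fun ξ => ?_
  exact Submodule.starProjection_eq_self_iff.1 (h5 ξ)

/-- Every representation that identifies idempotents has the norms of an integrated form: its
degenerate part is zero. -/
theorem IdentifiesIdempotents.exists_norm_le :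
    ∃ ρ : CovariantRep.{w} b, ∀ x, ‖φ.φ x‖ ≤ ‖ρ.integratedForm.φ x‖ := by
  have hK : ∀ x, (essSubspace (coeffRep φ) ⊤).starProjection * φ.φ x = φ.φ x := by
    intro x
    have h : (ContinuousLinearMap.mul ℂ (φ.H →L[ℂ] φ.H)
        (essSubspace (coeffRep φ) ⊤).starProjection).comp φ.toCLM = φ.toCLM := by
      refine L1.hom_ext fun s a => ?_
      have h1 := hφ.essProj_mul a.2
      change essProj (coeffRep φ) ⊤ * φ.φ (b.delta s a a.2) = φ.φ (b.delta s a a.2)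
      rw [← h1, ← mul_assoc, essProj_mul_essProj_of_le _ (le_top : b.D s ≤ ⊤)]
    exact congrArg (fun f => f x) h
  have hφ' : IdentifiesIdempotents (φ.restrict (essSubspace (coeffRep φ) ⊤) hK) := by
    intro e he a ha
    rw [coeffRep_apply, StarRep.restrict_apply, StarRep.restrict_apply, hφ e he a ha,
      coeffRep_apply]
  obtain ⟨ρ, hρ⟩ := hφ'.exists_covariantRep (essSubspace_coeffRep_restrict φ hK)
  exact ⟨ρ, fun x => (φ.norm_restrict _ hK x).trans (hρ x).le⟩

end Disintegration

end BusbySmithAction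

/-! ### Push-forward of convolution algebras along maps of index monoids -/

namespace TwistedSystem

/-- The inclusion of smaller into larger `*`-subalgebras as a bounded linear map. -/
def inclusionCLM {A : Type*} [NonUnitalCStarAlgebra A] {I J : NonUnitalStarSubalgebra ℂ A}
    (h : I ≤ J) : I →L[ℂ] J :=
  LinearMap.mkContinuous
    { toFun := fun a => ⟨a, h a.2⟩, map_add' := fun _ _ => rfl, map_smul' := fun _ _ => rfl } 1
    fun a => (one_mul ‖a‖).ge

section Star

variable {S A : Type*} [DivisionMonoid S] [NonUnitalCStarAlgebra A] {T : TwistedSystem S A}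

theorem L1.hasSum_single (x : T.L1) : HasSum (fun s => T.single s (x.coeff s)) x := by
  classical
  exact lp.hasSum_single (E := fun s => T.D s) (p := 1) (by simp) x

theorem fstar_add {s : S} {a c : A} (ha : a ∈ T.D s) (hc : c ∈ T.D s) :
    T.fstar s (a + c) = T.fstar s a + T.fstar s c := by
  have h : ∀ {d : A}, d ∈ T.D s → pmap (T.α s).symm (star d) ∈ T.J s⁻¹ s := fun hd => by
    rw [T.J_inv s]; exact pmap_mem _ (star_mem hd)
  rw [fstar, star_add, pmap_add _ (star_mem ha) (star_mem hc), rmul_add _ (h ha) (h hc)]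
  rfl

theorem L1.star_add (x y : T.L1) : star (x + y) = star x + star y :=
  L1.ext_coeff fun s => T.fstar_add (x.coeff s⁻¹).2 (y.coeff s⁻¹).2

theorem L1.norm_star_le (x : T.L1) : ‖star x‖ ≤ ‖x‖ :=
  hasSum_le (fun s => T.norm_fstar_le (x.coeff s⁻¹).2) (star x).hasSum_norm
    ((Equiv.inv S).hasSum_iff.2 x.hasSum_norm)

/-- Bounded linear maps that intertwine the involutions on the elements `a δ_s` are
`*`-preserving. -/
theorem L1.map_star_of_single {S' : Type*} [DivisionMonoid S'] {T' : TwistedSystem S' A}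
    (f : T.L1 →L[ℂ] T'.L1)
    (h : ∀ s (a : T.D s), f (star (T.single s a)) = star (f (T.single s a))) (x : T.L1) :
    f (star x) = star (f x) := by
  let st : T.L1 →+ T.L1 := AddMonoidHom.mk' star L1.star_add
  let st' : T'.L1 →+ T'.L1 := AddMonoidHom.mk' star L1.star_add
  have hst : Continuous st := AddMonoidHomClass.continuous_of_bound st 1 fun x => by
    rw [one_mul]; exact L1.norm_star_le x
  have hst' : Continuous st' := AddMonoidHomClass.continuous_of_bound st' 1 fun x => by
    rw [one_mul]; exact L1.norm_star_le x
  have h1 := ((L1.hasSum_single x).map st hst).map f f.continuous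
  have h2 := ((L1.hasSum_single x).map f f.continuous).map st' hst'
  refine h1.unique (Eq.mp ?_ h2)
  congr 1
  exact funext fun s => (h s (x.coeff s)).symm

end Star

/-- The map `σ` of index monoids carries the twisted system `T` into `T'`: it is compatible with
products and inverses, and the operations of `T` are restrictions of those of `T'`. -/
structure IsMorphism {S S' A : Type*} [DivisionMonoid S] [DivisionMonoid S']
    [NonUnitalCStarAlgebra A] (T : TwistedSystem S A) (T' : TwistedSystem S' A) (σ : S → S') :
    Prop where
  mul : ∀ s t, σ (s * t) = σ s * σ t
  inv : ∀ s, σ s⁻¹ = (σ s)⁻¹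
  D_le : ∀ s, T.D s ≤ T'.D (σ s)
  fmul_eq : ∀ s t, ∀ a ∈ T.D s, ∀ c ∈ T.D t, T.fmul s t a c = T'.fmul (σ s) (σ t) a c
  fstar_eq : ∀ s, ∀ a ∈ T.D s, T.fstar s a = T'.fstar (σ s) a

namespace IsMorphism

variable {S S' A : Type*} [DivisionMonoid S] [DivisionMonoid S'] [NonUnitalCStarAlgebra A]
  {T : TwistedSystem S A} {T' : TwistedSystem S' A} {σ : S → S'} (h : IsMorphism T T' σ)
include h

theorem norm_single_comp_inclusion_le (s : S) :
    ‖(T'.single (σ s)).comp (inclusionCLM (h.D_le s))‖ ≤ 1 :=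
  opNorm_le_bound _ zero_le_one fun _ => (T'.single (σ s)).le_of_opNorm_le (T'.norm_single_le _) _

/-- The bounded linear map with `a δ_s ↦ a δ_{σ(s)}`. -/
def pushCLM : T.L1 →L[ℂ] T'.L1 :=
  L1.lift (fun s => (T'.single (σ s)).comp (inclusionCLM (h.D_le s))) 1
    h.norm_single_comp_inclusion_le

theorem pushCLM_single (s : S) (a : T.D s) :
    h.pushCLM (T.single s a) = T'.single (σ s) ⟨a, h.D_le s a.2⟩ :=
  L1.lift_single _ 1 h.norm_single_comp_inclusion_le s a

/-- The `*`-homomorphism with `a δ_s ↦ a δ_{σ(s)}`. -/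
def push : T.L1 →⋆ₙₐ[ℂ] T'.L1 where
  toFun := h.pushCLM
  map_smul' c x := map_smul h.pushCLM c x
  map_zero' := map_zero h.pushCLM
  map_add' := map_add h.pushCLM
  map_mul' x y := by
    have h1 : ((compL ℂ T.L1 T.L1 T'.L1) h.pushCLM).comp T.mulCLM =
        ((compL ℂ T.L1 T'.L1 T'.L1).flip h.pushCLM).comp (T'.mulCLM.comp h.pushCLM) := by
      refine L1.hom_ext fun s a => L1.hom_ext fun t c => ?_
      change h.pushCLM (T.single s a * T.single t c) =
        h.pushCLM (T.single s a) * h.pushCLM (T.single t c)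
      rw [single_mul_single, pushCLM_single, pushCLM_single, pushCLM_single, single_mul_single]
      exact single_congr (h.mul s t) (h.fmul_eq s t a a.2 c c.2)
    exact congrArg (fun f => f x y) h1
  map_star' := L1.map_star_of_single h.pushCLM fun s a => by
    rw [star_single, pushCLM_single, pushCLM_single, star_single]
    exact single_congr (h.inv s) (h.fstar_eq s a a.2)

theorem push_single (s : S) (a : T.D s) :
    h.push (T.single s a) = T'.single (σ s) ⟨a, h.D_le s a.2⟩ :=
  h.pushCLM_single s a

theorem norm_push_le (x : T.L1) : ‖h.push x‖ ≤ ‖x‖ :=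
  (L1.norm_lift_le _ 1 h.norm_single_comp_inclusion_le x).trans (one_mul _).le

/-- The representation `x ↦ R (push x)`. -/
def pullback (R : StarRep T') : StarRep T where
  H := R.H
  φ := R.φ.comp h.push
  norm_le x := (R.norm_le _).trans (h.norm_push_le x)

variable {τ : S' → S} (hτ : ∀ s, σ (τ s) = s) (hD : ∀ s, T'.D s ≤ T.D (τ s))
include hτ hD

theorem push_surjective : Function.Surjective h.push := by
  have hb : ∀ s, ‖(T.single (τ s)).comp (inclusionCLM (hD s))‖ ≤ 1 := fun s =>
    opNorm_le_bound _ zero_le_one fun a => (T.single (τ s)).le_of_opNorm_le (T.norm_single_le _) _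
  have h1 : h.pushCLM.comp (L1.lift _ 1 hb) = ContinuousLinearMap.id ℂ T'.L1 := by
    refine L1.hom_ext fun s a => ?_
    rw [comp_apply, L1.lift_single, comp_apply, pushCLM_single]
    exact single_congr (hτ s) rfl
  exact fun y => ⟨L1.lift _ 1 hb y, congrArg (fun f => f y) h1⟩

/-- A representation that does not distinguish `a δ_s` from `a δ_{τ(σ(s))}` factors through
`push`. -/
theorem exists_descent.{w} (R : StarRep.{w} T)
    (hR : ∀ s (a : A) (ha : a ∈ T.D s) (ha' : a ∈ T.D (τ (σ s))),
      R.φ (T.single s ⟨a, ha⟩) = R.φ (T.single (τ (σ s)) ⟨a, ha'⟩)) :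
    ∃ R' : StarRep.{w} T', ∀ x, ‖R.φ x‖ = ‖R'.φ (h.push x)‖ := by
  let W : ∀ s, T'.D s →L[ℂ] (R.H →L[ℂ] R.H) := fun s =>
    R.toCLM.comp ((T.single (τ s)).comp (inclusionCLM (hD s)))
  have hW : ∀ s, ‖W s‖ ≤ 1 := fun s => opNorm_le_bound _ zero_le_one fun a =>
    (R.norm_le _).trans ((T.single (τ s)).le_of_opNorm_le (T.norm_single_le _) _)
  have hWs : ∀ s s' (a : A) (ha : a ∈ T.D s) (hs : σ s = s') (ha' : a ∈ T'.D s'),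
      R.φ (T.single s ⟨a, ha⟩) = W s' ⟨a, ha'⟩ := by
    rintro s _ a ha rfl ha'
    exact hR s a ha _
  let R' : StarRep T' := StarRep.ofFamily T' W hW
    (fun s t a c => by
      have h1 : W s a * W t c =
          R.φ (T.single (τ s) ⟨a, hD s a.2⟩ * T.single (τ t) ⟨c, hD t c.2⟩) :=
        (map_mul R.φ _ _).symm
      have hm : σ (τ s * τ t) = s * t := by rw [h.mul, hτ, hτ]
      have hf := h.fmul_eq (τ s) (τ t) a (hD s a.2) c (hD t c.2)
      rw [hτ, hτ] at hf
      have hmem := (T'.fmulCLM s t a c).2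
      rw [coe_fmulCLM, ← hf] at hmem
      rw [h1, single_mul_single]
      refine Eq.trans ?_ (hWs _ _ _ (T.fmul_mem (hD s a.2) (hD t c.2)) hm hmem).symm
      exact congrArg (W (s * t)) (Subtype.ext hf.symm))
    (fun s a => by
      have h1 : star (W s a) = R.φ (star (T.single (τ s) ⟨a, hD s a.2⟩)) :=
        (map_star R.φ _).symm
      have hi : σ (τ s)⁻¹ = s⁻¹ := by rw [h.inv, hτ]
      have hf := h.fstar_eq (τ s) a (hD s a.2)
      rw [hτ] at hf
      have hmem := T'.fstar_mem a.2
      rw [← hf] at hmem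
      rw [h1, star_single]
      refine Eq.trans ?_ (hWs _ _ _ (T.fstar_mem (hD s a.2)) hi hmem).symm
      exact congrArg (W s⁻¹) (Subtype.ext hf.symm))
  let ψ : T'.L1 →L[ℂ] (R.H →L[ℂ] R.H) := L1.lift W 1 hW
  have hψ : R.toCLM = ψ.comp h.pushCLM := by
    refine L1.hom_ext fun s a => ?_
    rw [comp_apply, pushCLM_single, L1.lift_single]
    exact hWs s _ a a.2 rfl (h.D_le s a.2)
  exact ⟨R', fun x => congrArg (fun f : T.L1 →L[ℂ] (R.H →L[ℂ] R.H) => ‖f x‖) hψ⟩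

end IsMorphism

/-- Comparison of the seminorms that two families of representations define. -/
theorem norm_repMap_le {S S' A A' : Type*} [DivisionMonoid S] [DivisionMonoid S']
    [NonUnitalCStarAlgebra A] [NonUnitalCStarAlgebra A'] {T : TwistedSystem S A}
    {T' : TwistedSystem S' A'} {ι κ : Type*} {R : ι → StarRep T} {R' : κ → StarRep T'} {x : T.L1}
    {y : T'.L1} (h : ∀ i, ∃ j, ‖(R i).φ x‖ ≤ ‖(R' j).φ y‖) : ‖repMap R x‖ ≤ ‖repMap R' y‖ := by
  have hb : BddAbove (Set.range fun j => ‖(R' j).φ y‖) := ⟨‖y‖, by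
    rintro _ ⟨j, rfl⟩
    exact (R' j).norm_le y⟩
  rw [norm_repMap R]
  refine Real.iSup_le (fun i => ?_) (norm_nonneg _)
  obtain ⟨j, hj⟩ := h i
  rw [norm_repMap]
  exact hj.trans (le_ciSup hb j)

end TwistedSystem

/-! ### Corresponding twisted actions -/

open TwistedSystem

namespace BusbySmithAction

/-- `π(a) V_{eq} = π(a) V_q` for `a ∈ A_{eq}` and idempotent `e`. -/
theorem CovariantRep.map_mul_V_idempotent_mul {S A : Type*} [InverseMonoid S]
    [NonUnitalCStarAlgebra A] {b : BusbySmithAction S A} (ρ : CovariantRep b) {e : S}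
    (he : IsIdempotentElem e) (q : S) {a : A} (ha : a ∈ b.D (e * q)) :
    ρ.π a * ρ.V (e * q) = ρ.π a * ρ.V q := by
  have h := ρ.map_mul_V_mul_V ha
  rw [b.w_idempotent e q (Or.inl he), rmul_one ha,
    ρ.V_idempotent he (inv_eq_of_isIdempotentElem he), ← mul_assoc,
    map_mul_essProj _ (b.D_mul_le e q ha)] at h
  exact h.symm

namespace Corresponds

variable {G A : Type*} [Group G] [NonUnitalCStarAlgebra A] {θ : TwistedPartialAction G A}
  {b : BusbySmithAction (ExelSemigroup G) A} (hb : b.Corresponds θ)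
include hb

theorem D_le (p : ExelSemigroup G) : b.D p ≤ θ.D p.elt := by
  rw [hb.D_eq]
  exact iInf₂_le p.elt p.elt_mem

theorem le_D_of (s : G) : θ.D s ≤ b.D (ExelSemigroup.of s) := by
  rw [hb.D_eq]
  refine le_iInf₂ fun g hg => ?_
  have h : g = 1 ∨ g = s := by
    simpa [ExelSemigroup.of, ExelSemigroup.ofCanonical] using hg
  rcases h with rfl | rfl
  · rw [θ.D_one]; exact le_top
  · exact le_rfl

theorem symm_β_eq (p : ExelSemigroup G) {a : A} (ha : a ∈ b.D p) :
    pmap (b.β p).symm a = pmap (θ.α p.elt).symm a := by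
  have hk : pmap (b.β p).symm a ∈ b.D p⁻¹ := pmap_mem _ ha
  have h := hb.β_eq p _ hk
  rw [pmap_pmap_symm _ ha] at h
  have h2 := congrArg (pmap (θ.α p.elt).symm) h
  rw [pmap_symm_pmap _ (hb.D_le p⁻¹ hk)] at h2
  exact h2.symm

theorem isMorphism :
    IsMorphism b.toTwistedSystem θ.toTwistedSystem (ExelSemigroup.elt (G := G)) where
  mul _ _ := rfl
  inv _ := rfl
  D_le := hb.D_le
  fmul_eq p q a ha c hc := by
    have hin : pmap (b.β p).symm a * c ∈ b.D p⁻¹ := (b.toTwistedSystem.inner_mem ha hc).1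
    have hJ : pmap (b.β p) (pmap (b.β p).symm a * c) ∈ b.D (p * q) :=
      b.toTwistedSystem.fmul_mem_J ha hc
    change rmul (b.w p q) (pmap (b.β p) (pmap (b.β p).symm a * c)) =
      rmul (θ.u p.elt q.elt) (pmap (θ.α p.elt) (pmap (θ.α p.elt).symm a * c))
    rw [hb.rmul_w p q _ hJ, ← hb.symm_β_eq p ha,
      hb.β_eq p _ hin]
  fstar_eq p a ha := by
    change rmul (star (b.w p⁻¹ p)) (pmap (b.β p).symm (star a)) =
      rmul (star (θ.u p.elt⁻¹ p.elt)) (pmap (θ.α p.elt).symm (star a))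
    rw [← hb.symm_β_eq p (star_mem ha)]
    have hk : pmap (b.β p).symm (star a) ∈ b.D p⁻¹ := pmap_mem _ (star_mem ha)
    have hk1 := (b.D_inv_mul p).ge hk
    have hk2 : pmap (b.β p).symm (star a) ∈ θ.D p.elt⁻¹ ⊓ θ.D (p.elt⁻¹ * p.elt) :=
      (θ.toTwistedSystem.J_inv p.elt).ge (hb.D_le p⁻¹ hk)
    rw [← star_inj, star_rmul_star _ hk1, star_rmul_star _ hk2]
    exact hb.lmul_w p⁻¹ p _ (star_mem hk1)

/-- Representations of `L¹` of the group that are pulled back to `S(G)` identify idempotents,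
because these lie over the unit of the group. -/
theorem identifiesIdempotents_pullback (R : StarRep θ.toTwistedSystem) :
    IdentifiesIdempotents (hb.isMorphism.pullback R) := by
  intro e he a ha
  have h1 : e.elt = 1 := by
    have h := congrArg ExelSemigroup.elt he.eq
    rwa [ExelSemigroup.mul_elt, mul_eq_left] at h
  have h2 : hb.isMorphism.push (b.delta e a ha) =
      hb.isMorphism.push (b.delta 1 a (b.mem_D_one a)) := by
    rw [delta, delta, IsMorphism.push_single, IsMorphism.push_single]
    exact single_congr h1 rfl
  exact congrArg R.φ h2

end Corresponds

end BusbySmithAction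

theorem ExelSemigroup.mul_inv_mul_of {G : Type*} [Group G] (p : ExelSemigroup G) :
    p * p⁻¹ * of p.elt = p := by
  rw [ext_iff']
  refine ⟨by simp [mul_elt, inv_elt, of, ofCanonical], fun g => ?_⟩
  have h1 := p.one_mem
  have h2 := p.elt_mem
  simp only [mem_mul_supp, mem_inv_supp, mul_elt, inv_elt, mul_inv_cancel_left, or_self,
    mul_inv_cancel, inv_one, one_mul, of, ofCanonical, List.toFinset_nil, Finset.mem_insert,
    insert_empty_eq, Finset.mem_singleton]
  constructor
  · rintro (h | rfl | rfl) <;> assumption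
  · exact Or.inl

/-- Integrated forms of covariant representations of `S(G)` factor through `L¹` of the group, since
every `p ∈ S(G)` over `s` is `e [s]` for an idempotent `e`. -/
theorem BusbySmithAction.Corresponds.exists_starRep.{w} {G A : Type*} [Group G]
    [NonUnitalCStarAlgebra A] {θ : TwistedPartialAction G A}
    {b : BusbySmithAction (ExelSemigroup G) A} (hb : b.Corresponds θ) (ρ : CovariantRep.{w} b) :
    ∃ R : StarRep.{w} θ.toTwistedSystem,
      ∀ x, ‖ρ.integratedForm.φ x‖ = ‖R.φ (hb.isMorphism.push x)‖ := by
  refine hb.isMorphism.exists_descent (τ := ExelSemigroup.of) (fun _ => rfl) hb.le_D_of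
    ρ.integratedForm fun p a ha ha' => ?_
  refine (ρ.integratedForm_delta ha).trans (Eq.trans ?_ (ρ.integratedForm_delta ha').symm)
  have hp := p.mul_inv_mul_of
  have h := ρ.map_mul_V_idempotent_mul (isIdempotentElem_mul_inv p) (ExelSemigroup.of p.elt)
    (a := a) (by rwa [hp])
  rwa [hp] at h

end

theorem mainTheorem10 {G A : Type*} [Group G] [NonUnitalCStarAlgebra A]
    (θ : TwistedPartialAction G A) (b : BusbySmithAction (ExelSemigroup G) A)
    (hb : b.Corresponds θ) :
    Nonempty (θ.CrossedProduct ≃⋆ₐ[ℂ] b.CrossedProduct) := by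
  have hsurj := hb.isMorphism.push_surjective (τ := ExelSemigroup.of) (fun _ => rfl) hb.le_D_of
  let R := TwistedSystem.repMap fun φ : TwistedSystem.StarRep θ.toTwistedSystem => φ
  let R' := TwistedSystem.repMap fun ρ : BusbySmithAction.CovariantRep b => ρ.integratedForm
  have hnorm : ∀ x, ‖R.comp hb.isMorphism.push x‖ = ‖R' x‖ := fun x =>
    le_antisymm
      (TwistedSystem.norm_repMap_le fun φ => by
        obtain ⟨ρ, hρ⟩ := (hb.identifiesIdempotents_pullback φ).exists_norm_le
        exact ⟨ρ, hρ x⟩)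
      (TwistedSystem.norm_repMap_le fun ρ => by
        obtain ⟨φ, hφ⟩ := hb.exists_starRep ρ
        exact ⟨φ, (hφ x).le⟩)
  have hrange : NonUnitalStarAlgHom.range (R.comp hb.isMorphism.push) =
      NonUnitalStarAlgHom.range R :=
    SetLike.coe_injective (hsurj.range_comp R)
  have h := nonempty_closure_range_equiv (R.comp hb.isMorphism.push) R' hnorm
  rw [hrange] at h
  exact h
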